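/- **Setting.** Let $\mathcal S,\mathcal A$ be measurable spaces with countably generated $\sigma$-algebras and $H$ an episode length. An environment is a tuple $\mathcal E=\{(P_h,r_h)\}_{h=1}^H$ of Markov kernels $P_h(\cdot|s,a)$ on $\mathcal S$ and $r_h(\cdot|s,a)$ on $[0,1]$. In each layer, $P_h$ and $r_h$ range over families (jointly measurable in the parameter and $(s,a)$) parametrized by standard Borel spaces $\Theta^P_h$, $\Theta^R_h$ with prior probability measures $\rho^P_h,\rho^R_h$; all of these are independent, i.e. the prior on $\Theta=\prod_h\Theta^P_h\times\prod_h\Theta^R_h$ is the product measure $\rho$. An episode of a stationary policy $\pi=(\pi_h)$ in $\mathcal E$ starts at a fixed $s_1$; in layer $h$ one draws $a_h\sim\pi_h(\cdot|s_h)$ and then, independently, $r_h\sim r_h(\cdot|s_h,a_h)$ and $s_{h+1}\sim P_h(\cdot|s_h,a_h)$. Let $\mathcal E\mapsto\pi^*_{\mathcal E}$ be a measurable choice of a policy that is optimal for $\mathcal E$ (from every layer and state) within a class $\Pi$ of stationary policies. The history of episode $\ell$ is $\mathcal H_{\ell,H}=(s_1,a_1,r_1,\dots,s_H,a_H,r_H,s_{H+1})$,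 and $\mathcal D_\ell=(\mathcal H_{1,H},\dots,\mathcal H_{\ell-1,H})$ is generated by Thompson sampling (TS): in each episode $j$ one samples $\mathcal E_j$ from the posterior given $\mathcal D_j$, independently of the true environment $\mathcal E\sim\rho$, and plays $\pi^j_{\rm TS}=\pi^*_{\mathcal E_j}$ in $\mathcal E$. Let $\mathbb P_\ell=\mathbb P(\cdot|\mathcal D_\ell)$ and let $\mathbb E_\ell$ be its expectation. Let $\varepsilon>0$ and let $\Theta=\bigsqcup_{k=1}^K\Theta_k$ be a measurable layered $\varepsilon$-value partition, $\zeta(\mathcal E)=k\iff\mathcal E\in\Theta_k$. This means: $V^{\mathcal E}_{1,\pi^*_{\mathcal E}}(s_1)-V^{\mathcal E'}_{1,\pi^*_{\mathcal E}}(s_1)\le\varepsilon$ whenever $\zeta(\mathcal E)=\zeta(\mathcal E')$; the partition is formed layer by layer, i.e. there are measurable labels $c_h:\Theta^P_h\times\Theta^R_h\to\mathbb N$ with $\zeta(\mathcal E)=\zeta(\mathcal E')$ iff $c_h(P_h,r_h)=c_h(P_h',r_h')$ for all $h$; and, under $\rho$ conditioned on a cell of positive mass, the layers are independent and, in each layer,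 $P_h$ and $r_h$ are independent. The surrogate environment is $\tilde{\mathcal E}^*_\ell=\mathbb E_\ell[\mathcal E\mid\zeta]$, i.e. it equals $\tilde{\mathcal E}^*_{k,\ell}=\mathbb E_\ell[\mathcal E\mid\mathcal E\in\Theta_k]$ when the true environment lies in $\Theta_k$, and $\bar{\mathcal E}_\ell=\mathbb E_\ell[\mathcal E]$ is the mean environment (means of kernels, for each $(s,a)$). Let $$\mathbb I^{\pi^\ell_{\rm TS}}_\ell(\tilde{\mathcal E}^*_\ell;\mathcal H_{\ell,H})=\mathbb E_{\pi^\ell_{\rm TS}}\Big[D_{\rm KL}\big(\mathbb P_\ell((\tilde{\mathcal E}^*_\ell,\mathcal H_{\ell,H})\in\cdot\,|\,\pi^\ell_{\rm TS})\,\big\|\,\mathbb P_\ell(\tilde{\mathcal E}^*_\ell\in\cdot\,|\,\pi^\ell_{\rm TS})\otimes\mathbb P_\ell(\mathcal H_{\ell,H}\in\cdot\,|\,\pi^\ell_{\rm TS})\big)\Big].$$ **Lemma.** For every $\ell\ge1$ and almost every $\mathcal D_\ell$, $$\mathbb I^{\pi^\ell_{\rm TS}}_\ell(\tilde{\mathcal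 E}^*_\ell;\mathcal H_{\ell,H})=\sum_{h=1}^H\mathbb E_\ell\Big[\mathbb E^{\bar{\mathcal E}_\ell}_{\pi^\ell_{\rm TS}}\Big[D_{\rm KL}\big((P_h^{\tilde{\mathcal E}^*_\ell}\otimes r_h^{\tilde{\mathcal E}^*_\ell})(\cdot|s_h,a_h)\,\big\|\,(P_h^{\bar{\mathcal E}_\ell}\otimes r_h^{\bar{\mathcal E}_\ell})(\cdot|s_h,a_h)\big)\Big]\Big],$$ where the inner expectation is over $(s_h,a_h)$ distributed according to the occupancy measure of $\pi^\ell_{\rm TS}$ in $\bar{\mathcal E}_\ell$, and the outer one over the independent pair $(\pi^\ell_{\rm TS},\tilde{\mathcal E}^*_\ell)$. If instead the histories (in $\mathcal D_\ell$ and in $\mathcal H_{\ell,H}$) do not record the terminal state $s_{H+1}$, the same identity holds with the transition kernels omitted from the term $h=H$, which then is $D_{\rm KL}(r_H^{\tilde{\mathcal E}^*_\ell}(\cdot|s_H,a_H)\|r_H^{\bar{\mathcal E}_\ell}(\cdot|s_H,a_H))$. As a special case, if the rewards are deterministic in the sense that the reward kernels are not random (each $r_h$ is the same kernel for $\rho^R_h$-almost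 every parameter, e.g. a known point mass), then $$\mathbb I^{\pi^\ell_{\rm TS}}_\ell(\tilde{\mathcal E}^*_\ell;\mathcal H_{\ell,H})=\sum_{h=1}^H\mathbb E_\ell\Big[\mathbb E^{\bar{\mathcal E}_\ell}_{\pi^\ell_{\rm TS}}\Big[D_{\rm KL}\big(P_h^{\tilde{\mathcal E}^*_\ell}(\cdot|s_h,a_h)\,\big\|\,P_h^{\bar{\mathcal E}_\ell}(\cdot|s_h,a_h)\big)\Big]\Big],$$ with the term $h=H$ omitted if the terminal state is not recorded. -/

import Mathlib

open MeasureTheory ProbabilityTheory InformationTheory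
open scoped ENNReal

namespace BayesRL

section Environments

variable {S A : Type*} [MeasurableSpace S] [MeasurableSpace A] {H : ℕ}

/-- A finite-horizon environment with `H` layers: Markov transition kernels
`P_h(· | s, a)` and reward kernels `r_h(· | s, a)` on `[0, 1]`.
Layers are numbered `0, …, H - 1`. -/
structure Env (S A : Type*) [MeasurableSpace S] [MeasurableSpace A] (H : ℕ) where
  trans : Fin H → Kernel (S × A) S
  rew : Fin H → Kernel (S × A) unitInterval
  trans_markov : ∀ h, IsMarkovKernel (trans h)
  rew_markov : ∀ h, IsMarkovKernel (rew h)

attribute [instance] Env.trans_markov Env.rew_markov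

/-- The surrogate environment below takes finitely many values, and the mutual information of a
finitely valued random variable is the one for the discrete σ-algebra on its values. -/
instance : MeasurableSpace (Env S A H) := ⊤

/-- A stationary policy: the law of the action depends on the layer and the current state. -/
structure Policy (S A : Type*) [MeasurableSpace S] [MeasurableSpace A] (H : ℕ) where
  act : Fin H → Kernel S A
  act_markov : ∀ h, IsMarkovKernel (act h)

attribute [instance] Policy.act_markov

/-- The value of policy `π` in environment `E` when `k` layers remain to be played. -/
noncomputable def valueToGo (E : Env S A H) (π : Policy S A H) : (k : ℕ) → k ≤ H → S → ℝ
  | 0, _ => fun _ => 0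
  | k + 1, hk => fun s =>
      ∫ a, ((∫ x, (x : ℝ) ∂(E.rew ⟨H - (k + 1), by omega⟩ (s, a)))
        + ∫ s', valueToGo E π k (by omega) s' ∂(E.trans ⟨H - (k + 1), by omega⟩ (s, a)))
        ∂(π.act ⟨H - (k + 1), by omega⟩ s)

/-- The value function `V_{h, π}^E`; the first layer is `h = 0`. -/
noncomputable def value (E : Env S A H) (π : Policy S A H) (h : ℕ) (s : S) : ℝ :=
  valueToGo E π (H - h) (Nat.sub_le H h) s

end Environments

section Trajectories

variable {Z S A : Type*} [MeasurableSpace Z] [MeasurableSpace S] [MeasurableSpace A] {H : ℕ}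

/-- `n` consecutive triples (state, action, reward). -/
abbrev Prefix (S A : Type*) (n : ℕ) : Type _ := Fin n → S × A × unitInterval

/-- A full episode: the triples `(s_h, a_h, r_h)` of all `H` layers, and the terminal state
`s_{H+1}`. -/
abbrev Traj (S A : Type*) (H : ℕ) : Type _ := Prefix S A H × S

theorem measurable_snoc {X : Type*} [MeasurableSpace X] (n : ℕ) :
    Measurable fun p : (Fin n → X) × X => (Fin.snoc p.1 p.2 : Fin (n + 1) → X) := by
  refine measurable_pi_iff.2 fun i => ?_
  refine Fin.lastCases ?_ (fun j => ?_) i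
  · simpa using measurable_snd
  · simp only [Fin.snoc_castSucc]
    exact (measurable_pi_apply j).comp measurable_fst

/-- Append a triple `(s, a, r)` to the past and move to the new state `s'`. -/
def extend {n : ℕ} (q : (Z × (Prefix S A n × S)) × (A × (unitInterval × S))) :
    Prefix S A (n + 1) × S :=
  (Fin.snoc q.1.2.1 (q.1.2.2, q.2.1, q.2.2.1), q.2.2.2)

theorem measurable_extend (n : ℕ) :
    Measurable (extend : (Z × (Prefix S A n × S)) × (A × (unitInterval × S)) → _) := by
  refine Measurable.prodMk ?_ (by fun_prop)
  exact (measurable_snoc n).comp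
    (g := fun p : Prefix S A n × (S × A × unitInterval) => (Fin.snoc p.1 p.2 : Prefix S A (n + 1)))
    (f := fun q : (Z × (Prefix S A n × S)) × (A × (unitInterval × S)) =>
      (q.1.2.1, (q.1.2.2, q.2.1, q.2.2.1))) (by fun_prop)

/-- One layer of interaction.  Given the parameter `z`, the past and the current state `s`:
draw `a ∼ π(· | z, s)`, then independently `r ∼ R(· | z, s, a)` and `s' ∼ P(· | z, s, a)`;
append `(s, a, r)` to the past and move to `s'`. -/
noncomputable def stepKernel (P : Kernel (Z × (S × A)) S) (R : Kernel (Z × (S × A)) unitInterval)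
    (π : Kernel (Z × S) A) (n : ℕ) :
    Kernel (Z × (Prefix S A n × S)) (Prefix S A (n + 1) × S) :=
  (Kernel.id ×ₖ
    (π.comap (fun q : Z × (Prefix S A n × S) => (q.1, q.2.2)) (by fun_prop) ⊗ₖ
      (R ×ₖ P).comap (fun q : (Z × (Prefix S A n × S)) × A => (q.1.1, (q.1.2.2, q.2)))
        (by fun_prop))).map extend

instance (P : Kernel (Z × (S × A)) S) (R : Kernel (Z × (S × A)) unitInterval)
    (π : Kernel (Z × S) A) (n : ℕ) [IsMarkovKernel P] [IsMarkovKernel R] [IsMarkovKernel π] :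
    IsMarkovKernel (stepKernel P R π n) :=
  Kernel.IsMarkovKernel.map _ (measurable_extend n)

/-- The law of the first `n` layers together with the state reached after them, as a kernel in a
parameter `z` on which the environment and the policy may depend. -/
noncomputable def prefixKernel (P : Fin H → Kernel (Z × (S × A)) S)
    (R : Fin H → Kernel (Z × (S × A)) unitInterval) (π : Fin H → Kernel (Z × S) A) (s₁ : S) :
    (n : ℕ) → n ≤ H → Kernel Z (Prefix S A n × S)
  | 0, _ => Kernel.const Z (Measure.dirac (Fin.elim0, s₁))
  | n + 1, hn =>
      Kernel.snd (prefixKernel P R π s₁ n (by omega) ⊗ₖ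
        stepKernel (P ⟨n, hn⟩) (R ⟨n, hn⟩) (π ⟨n, hn⟩) n)

/-- The law of a full episode that starts at `s₁`. -/
noncomputable def trajKernel (P : Fin H → Kernel (Z × (S × A)) S)
    (R : Fin H → Kernel (Z × (S × A)) unitInterval) (π : Fin H → Kernel (Z × S) A) (s₁ : S) :
    Kernel Z (Traj S A H) :=
  prefixKernel P R π s₁ H le_rfl

instance (P : Fin H → Kernel (Z × (S × A)) S) (R : Fin H → Kernel (Z × (S × A)) unitInterval)
    (π : Fin H → Kernel (Z × S) A) (s₁ : S) [∀ h, IsMarkovKernel (P h)]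
    [∀ h, IsMarkovKernel (R h)] [∀ h, IsMarkovKernel (π h)] (n : ℕ) (hn : n ≤ H) :
    IsMarkovKernel (prefixKernel P R π s₁ n hn) := by
  induction n with
  | zero => unfold prefixKernel; infer_instance
  | succ n ih =>
      have := ih (by omega)
      unfold prefixKernel
      infer_instance

instance (P : Fin H → Kernel (Z × (S × A)) S) (R : Fin H → Kernel (Z × (S × A)) unitInterval)
    (π : Fin H → Kernel (Z × S) A) (s₁ : S) [∀ h, IsMarkovKernel (P h)]
    [∀ h, IsMarkovKernel (R h)] [∀ h, IsMarkovKernel (π h)] :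
    IsMarkovKernel (trajKernel P R π s₁) := by
  unfold trajKernel
  infer_instance

end Trajectories

section Models

variable {S A : Type*} [MeasurableSpace S] [MeasurableSpace A] {H : ℕ}

/-- The parameter space `Θ = ∏_h Θ_h^P × ∏_h Θ_h^R` of all environments. -/
abbrev Param {H : ℕ} (ΘP ΘR : Fin H → Type*) : Type _ := (∀ h, ΘP h) × (∀ h, ΘR h)

/-- A Bayesian RL problem: spaces `Θ_h^P`, `Θ_h^R` of transition and of reward kernels of
layer `h`, a prior on each of them, and the initial state. -/
structure Model (S A : Type*) [MeasurableSpace S] [MeasurableSpace A] {H : ℕ}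
    (ΘP ΘR : Fin H → Type*) [∀ h, MeasurableSpace (ΘP h)] [∀ h, MeasurableSpace (ΘR h)] where
  trans : ∀ h, Kernel (ΘP h × (S × A)) S
  rew : ∀ h, Kernel (ΘR h × (S × A)) unitInterval
  priorP : ∀ h, Measure (ΘP h)
  priorR : ∀ h, Measure (ΘR h)
  s₁ : S
  trans_markov : ∀ h, IsMarkovKernel (trans h)
  rew_markov : ∀ h, IsMarkovKernel (rew h)
  priorP_prob : ∀ h, IsProbabilityMeasure (priorP h)
  priorR_prob : ∀ h, IsProbabilityMeasure (priorR h)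

attribute [instance] Model.trans_markov Model.rew_markov Model.priorP_prob Model.priorR_prob

variable {ΘP ΘR : Fin H → Type*} [∀ h, MeasurableSpace (ΘP h)] [∀ h, MeasurableSpace (ΘR h)]

namespace Model

variable (M : Model S A ΘP ΘR)

/-- The prior `ρ = ρ^P ⊗ ρ^R`: all layers, transitions and rewards are independent. -/
noncomputable def prior : Measure (Param ΘP ΘR) :=
  (Measure.pi M.priorP).prod (Measure.pi M.priorR)

instance : IsProbabilityMeasure M.prior := by
  unfold prior
  infer_instance

/-- `(θ, s, a) ↦ P_h^θ(· | s, a)`. -/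
noncomputable def transΘ (h : Fin H) : Kernel (Param ΘP ΘR × (S × A)) S :=
  (M.trans h).comap (fun z => (z.1.1 h, z.2)) (by fun_prop)

/-- `(θ, s, a) ↦ r_h^θ(· | s, a)`. -/
noncomputable def rewΘ (h : Fin H) : Kernel (Param ΘP ΘR × (S × A)) unitInterval :=
  (M.rew h).comap (fun z => (z.1.2 h, z.2)) (by fun_prop)

instance (h : Fin H) : IsMarkovKernel (M.transΘ h) := by
  unfold transΘ
  infer_instance

instance (h : Fin H) : IsMarkovKernel (M.rewΘ h) := by
  unfold rewΘ
  infer_instance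

/-- The environment with parameter `θ`. -/
noncomputable def env (θ : Param ΘP ΘR) : Env S A H where
  trans h := (M.transΘ h).sectR θ
  rew h := (M.rewΘ h).sectR θ
  trans_markov _ := inferInstance
  rew_markov _ := inferInstance

/-- The mean environment under a law `ν` on the environments:
its kernels are `∫ P_h^θ(· | s, a) dν(θ)` and `∫ r_h^θ(· | s, a) dν(θ)`. -/
noncomputable def meanEnv (ν : Measure (Param ΘP ΘR)) [IsProbabilityMeasure ν] : Env S A H where
  trans h := M.transΘ h ∘ₖ (Kernel.const (S × A) ν ×ₖ Kernel.id)
  rew h := M.rewΘ h ∘ₖ (Kernel.const (S × A) ν ×ₖ Kernel.id)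
  trans_markov _ := inferInstance
  rew_markov _ := inferInstance

theorem meanEnv_trans_apply (ν : Measure (Param ΘP ΘR)) [IsProbabilityMeasure ν] (h : Fin H)
    (x : S × A) {B : Set S} (hB : MeasurableSet B) :
    (M.meanEnv ν).trans h x B = ∫⁻ θ, (M.env θ).trans h x B ∂ν := by
  have hm : Measurable fun z => M.transΘ h z B := Kernel.measurable_coe _ hB
  simp only [meanEnv, env, Kernel.sectR_apply]
  rw [Kernel.comp_apply' _ _ _ hB, Kernel.prod_apply, Kernel.const_apply, Kernel.id_apply,
    lintegral_prod _ hm.aemeasurable]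
  refine lintegral_congr fun θ => ?_
  rw [lintegral_dirac' _ (by fun_prop)]

/-- A measurable choice `θ ↦ π*_θ` of a policy in `Pi` that is optimal, within `Pi`, for the
environment `θ` from every layer and every state. -/
structure OptimalSelector (Pi : Set (Policy S A H)) where
  sel : Param ΘP ΘR → Policy S A H
  measurable_sel : ∀ h, Measurable fun q : Param ΘP ΘR × S => (sel q.1).act h q.2
  sel_mem : ∀ θ, sel θ ∈ Pi
  optimal : ∀ θ, ∀ π ∈ Pi, ∀ (h : Fin H) (s : S),
    value (M.env θ) π h s ≤ value (M.env θ) (sel θ) h s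

variable {M} {Pi : Set (Policy S A H)} (σ : M.OptimalSelector Pi)

/-- `(θ, s) ↦ π*_θ(· | s)` at layer `h`. -/
noncomputable def OptimalSelector.kernel (h : Fin H) : Kernel (Param ΘP ΘR × S) A where
  toFun q := (σ.sel q.1).act h q.2
  measurable' := σ.measurable_sel h

instance (h : Fin H) : IsMarkovKernel (σ.kernel h) :=
  ⟨fun q => inferInstanceAs (IsProbabilityMeasure ((σ.sel q.1).act h q.2))⟩

/-- The law of an episode in the environment `θ` under the policy `π*_{θ'}`, as a kernel in
`(θ, θ')`. -/
noncomputable def episode : Kernel (Param ΘP ΘR × Param ΘP ΘR) (Traj S A H) :=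
  trajKernel (fun h => (M.transΘ h).comap (fun z => (z.1.1, z.2)) (by fun_prop))
    (fun h => (M.rewΘ h).comap (fun z => (z.1.1, z.2)) (by fun_prop))
    (fun h => (σ.kernel h).comap (fun z => (z.1.2, z.2)) (by fun_prop)) M.s₁

instance : IsMarkovKernel (episode σ) := by
  unfold episode
  infer_instance

/-- The law of an episode in a fixed environment `E` under the policy `π*_{θ'}`, as a kernel in
`θ'`. -/
noncomputable def episodeIn (E : Env S A H) : Kernel (Param ΘP ΘR) (Traj S A H) :=
  trajKernel (fun h => (E.trans h).prodMkLeft (Param ΘP ΘR))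
    (fun h => (E.rew h).prodMkLeft (Param ΘP ΘR)) σ.kernel M.s₁

/-- The occupancy measure: the law of `(s_h, a_h)` in the environment `E` under `π*_{θ'}`. -/
noncomputable def occupancy (E : Env S A H) (θ' : Param ΘP ΘR) (h : Fin H) : Measure (S × A) :=
  (episodeIn σ E θ').map fun w => ((w.1 h).1, (w.1 h).2.1)

/-- The law of the recorded history `obs (s_1, a_1, r_1, …)` of an episode in the environment `θ`
under `π*_{θ'}`, as a kernel in `(θ, θ')`. -/
noncomputable def record {O : Type*} [MeasurableSpace O] (obs : Traj S A H → O)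
    (hobs : Measurable obs) : Kernel (Param ΘP ΘR × Param ΘP ΘR) O :=
  Kernel.deterministic obs hobs ∘ₖ episode σ

instance {O : Type*} [MeasurableSpace O] (obs : Traj S A H → O) (hobs : Measurable obs) :
    IsMarkovKernel (record σ obs hobs) := by
  unfold record
  infer_instance

section ThompsonSampling

variable [∀ h, StandardBorelSpace (ΘP h)] [∀ h, StandardBorelSpace (ΘR h)]
  [∀ h, Nonempty (ΘP h)] [∀ h, Nonempty (ΘR h)]
  {O : Type*} [MeasurableSpace O] (obs : Traj S A H → O) (hobs : Measurable obs)

/-- Thompson sampling: given the data `D` of the past episodes and the kernel `κ` of their law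
given the true environment `θ`, draw `θ'` from the posterior given `D`, independently of `θ`, and
play `π*_{θ'}` in `θ` for one episode.  This is the law of the record of that episode. -/
noncomputable def nextRecord {X : Type*} [MeasurableSpace X]
    (κ : Kernel (Param ΘP ΘR) X) [IsMarkovKernel κ] : Kernel (Param ΘP ΘR × X) O :=
  Kernel.snd ((posterior κ M.prior).prodMkLeft (Param ΘP ΘR) ⊗ₖ
    (record σ obs hobs).comap (fun q : (Param ΘP ΘR × X) × Param ΘP ΘR => (q.1.1, q.2))
      (by fun_prop))

instance {X : Type*} [MeasurableSpace X] (κ : Kernel (Param ΘP ΘR) X) [IsMarkovKernel κ] :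
    IsMarkovKernel (nextRecord σ obs hobs κ) := by
  unfold nextRecord
  infer_instance

/-- The law of the data of the first `n` episodes of Thompson sampling given the true environment,
bundled with the proof that it is a Markov kernel. -/
noncomputable def dataAux :
    (n : ℕ) → {κ : Kernel (Param ΘP ΘR) (Fin n → O) // IsMarkovKernel κ}
  | 0 => ⟨Kernel.const _ (Measure.dirac Fin.elim0), inferInstance⟩
  | n + 1 =>
      haveI := (dataAux n).2
      ⟨((dataAux n).1 ⊗ₖ nextRecord σ obs hobs (dataAux n).1).map
          (fun p => (Fin.snoc p.1 p.2 : Fin (n + 1) → O)),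
        Kernel.IsMarkovKernel.map _ (measurable_snoc n)⟩

/-- The law of the data `D` of the first `n` episodes given the true environment. -/
noncomputable def data (n : ℕ) : Kernel (Param ΘP ΘR) (Fin n → O) := (dataAux σ obs hobs n).1

instance (n : ℕ) : IsMarkovKernel (data σ obs hobs n) := (dataAux σ obs hobs n).2

/-- The unconditional law of the data of the first `n` episodes. -/
noncomputable def dataLaw (n : ℕ) : Measure (Fin n → O) := M.prior.bind (data σ obs hobs n)

/-- The posterior law `P_ℓ` of the environment given the data of `n = ℓ - 1` episodes. -/
noncomputable def post (n : ℕ) (D : Fin n → O) : Measure (Param ΘP ΘR) :=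
  posterior (data σ obs hobs n) M.prior D

instance (n : ℕ) (D : Fin n → O) : IsProbabilityMeasure (post σ obs hobs n D) := by
  unfold post
  infer_instance

end ThompsonSampling

/-- A layered `ε`-value partition of the environments into the cells `{ζ = k}`, `k < K`. -/
structure IsLayeredValuePartition (ε : ℝ) {K : ℕ} (ζ : Param ΘP ΘR → Fin K) : Prop where
  measurable : Measurable ζ
  value_le : ∀ θ θ', ζ θ = ζ θ' →
    value (M.env θ) (σ.sel θ) 0 M.s₁ - value (M.env θ') (σ.sel θ) 0 M.s₁ ≤ ε
  /-- The cell of an environment amounts to a choice of one cell of `Θ_h^P × Θ_h^R` in each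
  layer `h`. -/
  layered : ∃ c : ∀ h, ΘP h × ΘR h → ℕ, (∀ h, Measurable (c h)) ∧
    ∀ θ θ', ζ θ = ζ θ' ↔ ∀ h, c h (θ.1 h, θ.2 h) = c h (θ'.1 h, θ'.2 h)
  /-- Conditionally on the cell, the layers are independent. -/
  indep_layers : ∀ k, M.prior (ζ ⁻¹' {k}) ≠ 0 →
    iIndepFun (fun h θ => (θ.1 h, θ.2 h)) (M.prior[|ζ ⁻¹' {k}])
  /-- Conditionally on the cell, transition and reward of a layer are independent. -/
  indep_rew : ∀ k, M.prior (ζ ⁻¹' {k}) ≠ 0 →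
    ∀ h, IndepFun (fun θ => θ.1 h) (fun θ => θ.2 h) (M.prior[|ζ ⁻¹' {k}])

open Classical in
/-- The surrogate environment of the cell `k`: the mean environment under the posterior `ν`
conditioned on the cell.  On a cell that is null for `ν` its value plays no role. -/
noncomputable def cellEnv (M : Model S A ΘP ΘR) (ν : Measure (Param ΘP ΘR))
    [IsProbabilityMeasure ν] {K : ℕ} (ζ : Param ΘP ΘR → Fin K) (k : Fin K) : Env S A H :=
  if hk : ν (ζ ⁻¹' {k}) ≠ 0 then
    haveI := cond_isProbabilityMeasure hk
    M.meanEnv (ν[|ζ ⁻¹' {k}])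
  else M.meanEnv ν

/-- The surrogate environment as a random variable: the surrogate of the cell of the true
environment. -/
noncomputable def surrogate (M : Model S A ΘP ΘR) (ν : Measure (Param ΘP ΘR))
    [IsProbabilityMeasure ν] {K : ℕ} (ζ : Param ΘP ΘR → Fin K) (θ : Param ΘP ΘR) : Env S A H :=
  cellEnv M ν ζ (ζ θ)

/-- Given a law `ν` of the true environment `θ` and the policy `π*_{θ'}`, the joint law of the
surrogate environment and of the record of an episode of `π*_{θ'}` in the true environment. -/
noncomputable def jointLaw {O : Type*} [MeasurableSpace O] (obs : Traj S A H → O)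
    (hobs : Measurable obs) (ν : Measure (Param ΘP ΘR)) [IsProbabilityMeasure ν] {K : ℕ}
    (ζ : Param ΘP ΘR → Fin K) (θ' : Param ΘP ΘR) : Measure (Env S A H × O) :=
  (ν ⊗ₘ (record σ obs hobs).sectL θ').map fun p => (surrogate M ν ζ p.1, p.2)

end Model

end Models

/-- The mutual information of two random variables with joint law `J`. -/
noncomputable def mutualInfo {X Y : Type*} [MeasurableSpace X] [MeasurableSpace Y]
    (J : Measure (X × Y)) : ℝ≥0∞ :=
  klDiv J (J.fst.prod J.snd)

namespace Model

variable {S A : Type*} [MeasurableSpace S] [MeasurableSpace A] {H : ℕ}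
  {ΘP ΘR : Fin H → Type*} [∀ h, MeasurableSpace (ΘP h)] [∀ h, MeasurableSpace (ΘR h)]
  {M : Model S A ΘP ΘR} {Pi : Set (Policy S A H)} (σ : M.OptimalSelector Pi)

/-- The mutual information of the surrogate environment and the record of the episode conditional
on the Thompson sampling policy: the true environment `θ` and the sample `θ'` that determines the
policy `π*_{θ'}` are independent with law `ν`. -/
noncomputable def tsMutualInfo {O : Type*} [MeasurableSpace O] (obs : Traj S A H → O)
    (hobs : Measurable obs) (ν : Measure (Param ΘP ΘR)) [IsProbabilityMeasure ν] {K : ℕ}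
    (ζ : Param ΘP ΘR → Fin K) : ℝ≥0∞ :=
  ∫⁻ θ', mutualInfo (jointLaw σ obs hobs ν ζ θ') ∂ν

/-- `E_ℓ E_{π_TS}^{mean MDP} [f(surrogate environment, s_h, a_h)]`: the true environment `θ`, which
determines the surrogate, and the sample `θ'` that determines the policy are independent with
law `ν`, and `(s_h, a_h)` follows the occupancy measure of `π*_{θ'}` in the mean environment. -/
noncomputable def tsExpect (ν : Measure (Param ΘP ΘR)) [IsProbabilityMeasure ν] {K : ℕ}
    (ζ : Param ΘP ΘR → Fin K) (h : Fin H) (f : Env S A H → S × A → ℝ≥0∞) : ℝ≥0∞ :=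
  ∫⁻ θ, ∫⁻ θ', ∫⁻ x, f (surrogate M ν ζ θ) x ∂(occupancy σ (M.meanEnv ν) θ' h) ∂ν ∂ν

end Model

end BayesRL

/-!
Condition on the data so far. For a fixed value of the data its likelihood is a product of factors
each of which involves only one of the parameters, so under the posterior, and under the posterior
conditioned on a cell of the partition, the parameters remain independent. This is formulated by
splicing: `CoordIndep ν` says that replacing any set of coordinates by those of an independent copy
does not change `ν`.

An episode uses every parameter once, so averaging it over independent parameters replaces each
kernel by its mean. Hence, given the played policy, the record has the law of an episode in
`E[ℰ ∣ ζ]` given the cell and of an episode in the mean environment unconditionally, and the mutual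
information is the mean Kullback-Leibler divergence between these two. By the chain rule it is a
sum over the layers of divergences of the kernels, integrated against the occupancy measure of the
*surrogate* environment. Since the cells are products over the layers, layer `h` of the surrogate
is independent of the layers before `h`, which alone determine the occupancy measure at `h`; these
average to the layers of the mean environment.
-/

namespace BayesRL

section KullbackLeibler

variable {X Y : Type*} [MeasurableSpace X] [MeasurableSpace Y]

theorem klDiv_map_of_leftInverse (μ ν : Measure X) [IsFiniteMeasure μ] [IsFiniteMeasure ν]
    {φ : X → Y} {ψ : Y → X} (hφ : Measurable φ) (hψ : Measurable ψ)
    (h : Function.LeftInverse ψ φ) : klDiv (μ.map φ) (ν.map φ) = klDiv μ ν := by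
  refine le_antisymm (klDiv_map_le μ ν hφ) ?_
  simpa [Measure.map_map hψ hφ, h.comp_eq_id] using klDiv_map_le (μ.map φ) (ν.map φ) hψ

theorem klDiv_prod_swap {μ₁ ν₁ : Measure X} {μ₂ ν₂ : Measure Y} [IsFiniteMeasure μ₁]
    [IsFiniteMeasure ν₁] [IsFiniteMeasure μ₂] [IsFiniteMeasure ν₂] :
    klDiv (μ₂.prod μ₁) (ν₂.prod ν₁) = klDiv (μ₁.prod μ₂) (ν₁.prod ν₂) := by
  rw [← Measure.prod_swap, ← Measure.prod_swap (μ := ν₁)]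
  exact klDiv_map_of_leftInverse _ _ measurable_swap measurable_swap Prod.swap_leftInverse

theorem klDiv_prod_same_right {μ₁ ν₁ : Measure X} {μ₂ : Measure Y} [IsProbabilityMeasure μ₁]
    [IsProbabilityMeasure ν₁] [IsProbabilityMeasure μ₂] :
    klDiv (μ₁.prod μ₂) (ν₁.prod μ₂) = klDiv μ₁ ν₁ := by
  rw [← Measure.compProd_const, ← Measure.compProd_const, klDiv_compProd_left]

section Kernels

variable [MeasurableSpace.CountableOrCountablyGenerated X Y] (κ η : Kernel X Y)

theorem measurable_ofReal_klFun_rnDeriv :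
    Measurable fun p : X × Y => ENNReal.ofReal (klFun (Kernel.rnDeriv κ η p.1 p.2).toReal) :=
  (measurable_klFun.comp (Kernel.measurable_rnDeriv κ η).ennreal_toReal).ennreal_ofReal

theorem klDiv_eq_ite_lintegral_kernel_rnDeriv [IsFiniteKernel κ] [IsFiniteKernel η] (x : X)
    [Decidable (κ x ≪ η x)] :
    klDiv (κ x) (η x) = if κ x ≪ η x then
      ∫⁻ y, ENNReal.ofReal (klFun (Kernel.rnDeriv κ η x y).toReal) ∂(η x) else ∞ := by
  simp only [klDiv_eq_lintegral_klFun]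
  congr 1
  refine lintegral_congr_ae ?_
  filter_upwards [Kernel.rnDeriv_eq_rnDeriv_measure (κ := κ) (η := η) (a := x)] with y hy
  rw [hy]

theorem measurable_klDiv_kernel [IsFiniteKernel κ] [IsFiniteKernel η] :
    Measurable fun x => klDiv (κ x) (η x) := by
  classical
  simp_rw [klDiv_eq_ite_lintegral_kernel_rnDeriv κ η]
  exact Measurable.ite (Kernel.measurableSet_absolutelyContinuous κ η)
    (measurable_ofReal_klFun_rnDeriv κ η).lintegral_kernel_prod_right' measurable_const

theorem rnDeriv_compProd_right_of_ac {μ : Measure X} [IsFiniteMeasure μ] [IsFiniteKernel κ]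
    [IsFiniteKernel η] (hac : ∀ᵐ x ∂μ, κ x ≪ η x) :
    (μ ⊗ₘ κ).rnDeriv (μ ⊗ₘ η) =ᵐ[μ ⊗ₘ η] fun p => Kernel.rnDeriv κ η p.1 p.2 := by
  have hfin : IsFiniteKernel (η.withDensity (Kernel.rnDeriv κ η)) := inferInstance
  have density : μ ⊗ₘ κ = (μ ⊗ₘ η).withDensity fun p => Kernel.rnDeriv κ η p.1 p.2 := by
    rw [← Measure.compProd_withDensity (Kernel.measurable_rnDeriv κ η)]
    refine Measure.compProd_congr ?_
    filter_upwards [hac] with x hx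
    rw [Kernel.withDensity_rnDeriv_eq hx]
  rw [density]
  exact Measure.rnDeriv_withDensity _ (Kernel.measurable_rnDeriv κ η)

theorem klDiv_compProd_right_of_ac {μ : Measure X} [IsFiniteMeasure μ] [IsFiniteKernel κ]
    [IsFiniteKernel η] (hac : ∀ᵐ x ∂μ, κ x ≪ η x) :
    klDiv (μ ⊗ₘ κ) (μ ⊗ₘ η) = ∫⁻ x, klDiv (κ x) (η x) ∂μ := by
  classical
  calc
    _ = ∫⁻ p, ENNReal.ofReal (klFun (Kernel.rnDeriv κ η p.1 p.2).toReal) ∂(μ ⊗ₘ η) := by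
      rw [klDiv_eq_lintegral_klFun_of_ac (Measure.absolutelyContinuous_compProd_right_iff.2 hac)]
      refine lintegral_congr_ae ?_
      filter_upwards [rnDeriv_compProd_right_of_ac κ η hac] with p hp
      rw [hp]
    _ = ∫⁻ x, ∫⁻ y, ENNReal.ofReal (klFun (Kernel.rnDeriv κ η x y).toReal) ∂(η x) ∂μ :=
      Measure.lintegral_compProd (measurable_ofReal_klFun_rnDeriv κ η)
    _ = _ := by
      refine lintegral_congr_ae ?_
      filter_upwards [hac] with x hx
      rw [klDiv_eq_ite_lintegral_kernel_rnDeriv κ η, if_pos hx]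

theorem klDiv_compProd_right_eq_lintegral (μ : Measure X) [IsFiniteMeasure μ] [IsFiniteKernel κ]
    [IsFiniteKernel η] : klDiv (μ ⊗ₘ κ) (μ ⊗ₘ η) = ∫⁻ x, klDiv (κ x) (η x) ∂μ := by
  by_cases hac : ∀ᵐ x ∂μ, κ x ≪ η x
  · exact klDiv_compProd_right_of_ac κ η hac
  · rw [klDiv_of_not_ac (mt Measure.absolutelyContinuous_compProd_right_iff.1 hac)]
    by_contra hne
    refine hac ?_
    filter_upwards [ae_lt_top (measurable_klDiv_kernel κ η) (Ne.symm hne)] with x hx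
    by_contra hx'
    simp [klDiv_of_not_ac hx'] at hx

end Kernels

variable {ι : Type*} [Countable ι] [MeasurableSpace ι] [DiscreteMeasurableSpace ι]
  [DiscreteMeasurableSpace X] (p : Measure ι) [IsFiniteMeasure p] {e : ι → X} (κ η : Kernel X Y)
  [IsMarkovKernel κ] [IsMarkovKernel η]

theorem klDiv_map_compProd_of_injective (he : Function.Injective e) :
    klDiv (p.map e ⊗ₘ κ) (p.map e ⊗ₘ η) = ∫⁻ i, klDiv (κ (e i)) (η (e i)) ∂p := by
  rcases isEmpty_or_nonempty ι with hι | hι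
  · simp [Measure.eq_zero_of_isEmpty p]
  have hme : Measurable e := .of_discrete
  have map_compProd_comap (τ : Kernel X Y) [IsMarkovKernel τ] :
      (p ⊗ₘ τ.comap e hme).map (Prod.map e id) = p.map e ⊗ₘ τ := by
    refine Measure.ext_of_lintegral _ fun F hF => ?_
    rw [lintegral_map hF (by fun_prop), Measure.lintegral_compProd (by fun_prop),
      Measure.lintegral_compProd hF, lintegral_map .of_discrete hme]
    rfl
  have left_inverse : Function.LeftInverse (Prod.map (Function.invFun e) id)
      (Prod.map e (id : Y → Y)) := fun q => Prod.ext (Function.leftInverse_invFun he q.1) rfl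
  rw [← map_compProd_comap, ← map_compProd_comap, klDiv_map_of_leftInverse _ _ (by fun_prop)
    (Measurable.of_discrete.prodMap measurable_id) left_inverse]
  exact klDiv_compProd_right_eq_lintegral _ _ p

theorem klDiv_map_compProd_eq_lintegral (e : ι → X) :
    klDiv (p.map e ⊗ₘ κ) (p.map e ⊗ₘ η) = ∫⁻ i, klDiv (κ (e i)) (η (e i)) ∂p := by
  have : Countable (Set.range e) := Set.countable_range e
  have : DiscreteMeasurableSpace (Set.range e) :=
    ⟨fun s => ⟨Subtype.val '' s, .of_discrete, Set.preimage_image_eq s Subtype.val_injective⟩⟩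
  have he : Measurable (Set.rangeFactorization e) := .of_discrete
  have : p.map e = (p.map (Set.rangeFactorization e)).map Subtype.val := by
    rw [Measure.map_map measurable_subtype_coe he, Set.rangeFactorization_eq]
  rw [this, klDiv_map_compProd_of_injective _ κ η Subtype.val_injective,
    lintegral_map .of_discrete he]
  rfl

end KullbackLeibler

section KernelIntegrals

variable {X V Y : Type*} [MeasurableSpace X] [MeasurableSpace V] [MeasurableSpace Y]

theorem measurable_lintegral_kernel (κ : Kernel V Y) [IsSFiniteKernel κ] {v : X → V}
    (hv : Measurable v) {F : X → Y → ℝ≥0∞} (hF : Measurable fun q : X × Y => F q.1 q.2) :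
    Measurable fun x => ∫⁻ y, F x y ∂(κ (v x)) :=
  hF.lintegral_kernel_prod_right (κ := κ.comap v hv)

end KernelIntegrals

section Append

variable {S A : Type*}

/-- `extend` without the parameter on which the environment and the policy depend. -/
def appendStep {n : ℕ} (q : ((Prefix S A n × S) × A) × (unitInterval × S)) :
    Prefix S A (n + 1) × S :=
  (Fin.snoc q.1.1.1 (q.1.1.2, q.1.2, q.2.1), q.2.2)

/-- The step `appendStep` when the new state is not recorded. -/
def appendReward {n : ℕ} (q : ((Prefix S A n × S) × A) × unitInterval) : Prefix S A (n + 1) :=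
  Fin.snoc q.1.1.1 (q.1.1.2, q.1.2, q.2)

/-- The inverse of `appendReward`. -/
def splitReward {n : ℕ} (w : Prefix S A (n + 1)) : ((Prefix S A n × S) × A) × unitInterval :=
  (((Fin.init w, (w (Fin.last n)).1), (w (Fin.last n)).2.1), (w (Fin.last n)).2.2)

theorem leftInverse_splitReward (n : ℕ) : Function.LeftInverse
    (splitReward : Prefix S A (n + 1) → _) appendReward := by
  intro q
  simp [splitReward, appendReward]

/-- The inverse of `appendStep`. -/
def splitStep {n : ℕ} (w : Prefix S A (n + 1) × S) :
    ((Prefix S A n × S) × A) × (unitInterval × S) :=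
  ((splitReward w.1).1, ((splitReward w.1).2, w.2))

theorem leftInverse_splitStep (n : ℕ) : Function.LeftInverse
    (splitStep : Prefix S A (n + 1) × S → _) appendStep := by
  intro q
  simp [splitStep, splitReward, appendStep]

end Append

section Trajectories

variable {Z S A : Type*} [MeasurableSpace Z] [MeasurableSpace S] [MeasurableSpace A] {H : ℕ}

@[fun_prop]
theorem measurable_appendReward (n : ℕ) :
    Measurable (appendReward : ((Prefix S A n × S) × A) × unitInterval → _) :=
  (measurable_snoc n).comp
    (g := fun p : Prefix S A n × (S × A × unitInterval) => (Fin.snoc p.1 p.2 : Prefix S A (n + 1)))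
    (f := fun q : ((Prefix S A n × S) × A) × unitInterval =>
      (q.1.1.1, (q.1.1.2, q.1.2, q.2))) (by fun_prop)

@[fun_prop]
theorem measurable_appendStep (n : ℕ) :
    Measurable (appendStep : ((Prefix S A n × S) × A) × (unitInterval × S) → _) :=
  ((measurable_appendReward n).comp
    (f := fun q : ((Prefix S A n × S) × A) × (unitInterval × S) => (q.1, q.2.1))
    (by fun_prop)).prodMk (by fun_prop)

theorem measurable_splitReward (n : ℕ) :
    Measurable (splitReward : Prefix S A (n + 1) → _) := by
  unfold splitReward Fin.init
  fun_prop

theorem measurable_splitStep (n : ℕ) :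
    Measurable (splitStep : Prefix S A (n + 1) × S → _) := by
  have past := (measurable_splitReward (S := S) (A := A) n).comp
    (measurable_fst : Measurable (Prod.fst : Prefix S A (n + 1) × S → _))
  exact past.fst.prodMk (past.snd.prodMk measurable_snd)

/-- A policy as a kernel from the past of an episode and its current state. -/
noncomputable def actionGivenPast (π : Kernel (Z × S) A) (z : Z) (n : ℕ) :
    Kernel (Prefix S A n × S) A :=
  π.comap (fun p => (z, p.2)) (by fun_prop)

instance (π : Kernel (Z × S) A) [IsMarkovKernel π] (z : Z) (n : ℕ) :
    IsMarkovKernel (actionGivenPast π z n) := by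
  unfold actionGivenPast
  infer_instance

/-- A kernel from state-action pairs, seen as a kernel from the past of an episode, its current
state and action. -/
noncomputable def outcomeGivenPast {Y : Type*} [MeasurableSpace Y] (κ : Kernel (Z × (S × A)) Y)
    (z : Z) (n : ℕ) : Kernel ((Prefix S A n × S) × A) Y :=
  κ.comap (fun p => (z, (p.1.2, p.2))) (by fun_prop)

instance {Y : Type*} [MeasurableSpace Y] (κ : Kernel (Z × (S × A)) Y) [IsMarkovKernel κ] (z : Z)
    (n : ℕ) : IsMarkovKernel (outcomeGivenPast κ z n) := by
  unfold outcomeGivenPast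
  infer_instance

variable (P P' : Fin H → Kernel (Z × (S × A)) S) (R R' : Fin H → Kernel (Z × (S × A)) unitInterval)
  (π : Fin H → Kernel (Z × S) A) (s₁ : S)

theorem prefixKernel_zero_apply (z : Z) :
    prefixKernel P R π s₁ 0 (Nat.zero_le H) z = Measure.dirac (Fin.elim0, s₁) := by
  rw [prefixKernel, Kernel.const_apply]

section Recursion

variable [∀ h, IsMarkovKernel (P h)] [∀ h, IsMarkovKernel (R h)] [∀ h, IsMarkovKernel (π h)]

theorem prefixKernel_succ_apply (n : ℕ) (hn : n + 1 ≤ H) (z : Z) :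
    prefixKernel P R π s₁ (n + 1) hn z =
      ((prefixKernel P R π s₁ n (by omega) z ⊗ₘ actionGivenPast (π ⟨n, hn⟩) z n) ⊗ₘ
        outcomeGivenPast (R ⟨n, hn⟩ ×ₖ P ⟨n, hn⟩) z n).map appendStep := by
  refine Measure.ext_of_lintegral _ fun F hF => ?_
  have hx := measurable_extend (Z := Z) (S := S) (A := A) n
  have hFa : Measurable fun q : ((Prefix S A n × S) × A) × (unitInterval × S) =>
    F (appendStep q) := by fun_prop
  rw [lintegral_map hF (by fun_prop), Measure.lintegral_compProd hFa,
    Measure.lintegral_compProd hFa.lintegral_kernel_prod_right',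
    prefixKernel, Kernel.snd_apply, lintegral_map hF measurable_snd,
    Kernel.lintegral_compProd _ _ _ (by fun_prop)]
  refine lintegral_congr fun p => ?_
  rw [stepKernel, Kernel.map_apply _ hx, lintegral_map (by fun_prop) hx,
    Kernel.prod_apply, Kernel.id_apply, Measure.dirac_prod,
    lintegral_map (by fun_prop) (by fun_prop), Kernel.lintegral_compProd _ _ _ (by fun_prop)]
  rfl

theorem lintegral_prefixKernel_succ (n : ℕ) (hn : n + 1 ≤ H) (z : Z)
    {F : Prefix S A (n + 1) × S → ℝ≥0∞} (hF : Measurable F) :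
    ∫⁻ w, F w ∂(prefixKernel P R π s₁ (n + 1) hn z) =
      ∫⁻ p, ∫⁻ a, ∫⁻ q, F (appendStep ((p, a), q))
        ∂((R ⟨n, hn⟩ ×ₖ P ⟨n, hn⟩) (z, (p.2, a))) ∂(π ⟨n, hn⟩ (z, p.2))
        ∂(prefixKernel P R π s₁ n (by omega) z) := by
  have hFa : Measurable fun q : ((Prefix S A n × S) × A) × (unitInterval × S) =>
    F (appendStep q) := by fun_prop
  rw [prefixKernel_succ_apply, lintegral_map hF (by fun_prop), Measure.lintegral_compProd hFa,
    Measure.lintegral_compProd hFa.lintegral_kernel_prod_right']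
  rfl

theorem map_fst_prefixKernel_succ (n : ℕ) (hn : n + 1 ≤ H) (z : Z) :
    (prefixKernel P R π s₁ (n + 1) hn z).map Prod.fst =
      ((prefixKernel P R π s₁ n (by omega) z ⊗ₘ actionGivenPast (π ⟨n, hn⟩) z n) ⊗ₘ
        outcomeGivenPast (R ⟨n, hn⟩) z n).map appendReward := by
  have forget_state : (outcomeGivenPast (R ⟨n, hn⟩ ×ₖ P ⟨n, hn⟩) z n).map Prod.fst
      = outcomeGivenPast (R ⟨n, hn⟩) z n := by
    ext1 p
    rw [Kernel.map_apply _ measurable_fst]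
    simp [outcomeGivenPast, Kernel.prod_apply]
  rw [prefixKernel_succ_apply, ← forget_state, Measure.compProd_map measurable_fst,
    Measure.map_map measurable_fst (by fun_prop), Measure.map_map (by fun_prop) (by fun_prop)]
  rfl

theorem prefixKernel_congr {Z' : Type*} [MeasurableSpace Z'] {P' : Fin H → Kernel (Z' × (S × A)) S}
    {R' : Fin H → Kernel (Z' × (S × A)) unitInterval} {π' : Fin H → Kernel (Z' × S) A}
    [∀ h, IsMarkovKernel (P' h)] [∀ h, IsMarkovKernel (R' h)] [∀ h, IsMarkovKernel (π' h)]
    (z : Z) (z' : Z') (n : ℕ) (hn : n ≤ H)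
    (hP : ∀ h : Fin H, (h : ℕ) < n → ∀ x, P h (z, x) = P' h (z', x))
    (hR : ∀ h : Fin H, (h : ℕ) < n → ∀ x, R h (z, x) = R' h (z', x))
    (hπ : ∀ h : Fin H, (h : ℕ) < n → ∀ s, π h (z, s) = π' h (z', s)) :
    prefixKernel P R π s₁ n hn z = prefixKernel P' R' π' s₁ n hn z' := by
  induction n with
  | zero => rw [prefixKernel_zero_apply, prefixKernel_zero_apply]
  | succ n ih =>
      refine Measure.ext_of_lintegral _ fun F hF => ?_
      rw [lintegral_prefixKernel_succ _ _ _ _ _ _ _ hF,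
        lintegral_prefixKernel_succ _ _ _ _ _ _ _ hF,
        ih (by omega) (fun h hh => hP h (by omega)) (fun h hh => hR h (by omega))
          (fun h hh => hπ h (by omega))]
      have hlt : ((⟨n, hn⟩ : Fin H) : ℕ) < n + 1 := Nat.lt_succ_self n
      simp_rw [Kernel.prod_apply, hP _ hlt, hR _ hlt, hπ _ hlt]

theorem lintegral_stateAction_prefixKernel (z : Z) (h : Fin H) {F : S × A → ℝ≥0∞}
    (hF : Measurable F) (n : ℕ) (hn : n ≤ H) (hh : (h : ℕ) < n) :
    ∫⁻ w, F ((w.1 ⟨h, hh⟩).1, (w.1 ⟨h, hh⟩).2.1) ∂(prefixKernel P R π s₁ n hn z) =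
      ∫⁻ p, ∫⁻ a, F (p.2, a) ∂(π h (z, p.2))
        ∂(prefixKernel P R π s₁ (h : ℕ) h.2.le z) := by
  induction n with
  | zero => omega
  | succ n ih =>
      rw [lintegral_prefixKernel_succ _ _ _ _ _ _ _ (by fun_prop)]
      rcases Nat.lt_succ_iff_lt_or_eq.1 hh with hlt | heq
      · have earlier (p : Prefix S A n × S) a q :
            (appendStep ((p, a), q)).1 ⟨h, hh⟩ = p.1 ⟨h, hlt⟩ :=
          Fin.snoc_castSucc (α := fun _ => S × A × unitInterval) (p.2, a, q.1) p.1 ⟨h, hlt⟩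
        simpa [earlier] using ih (by omega) hlt
      · subst heq
        have latest (p : Prefix S A (h : ℕ) × S) a q :
            (appendStep ((p, a), q)).1 ⟨h, hh⟩ = (p.2, a, q.1) :=
          Fin.snoc_last (α := fun _ => S × A × unitInterval) (p.2, a, q.1) p.1
        simp [latest]

end Recursion

section ChainRule

variable [∀ h, IsMarkovKernel (P h)] [∀ h, IsMarkovKernel (R h)] [∀ h, IsMarkovKernel (P' h)]
  [∀ h, IsMarkovKernel (R' h)] [∀ h, IsMarkovKernel (π h)]

theorem klDiv_map_fst_prefixKernel_succ (n : ℕ) (hn : n + 1 ≤ H) (z : Z) :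
    klDiv ((prefixKernel P R π s₁ (n + 1) hn z).map Prod.fst)
        ((prefixKernel P' R' π s₁ (n + 1) hn z).map Prod.fst) =
      klDiv (prefixKernel P R π s₁ n (by omega) z) (prefixKernel P' R' π s₁ n (by omega) z) +
        ∫⁻ p, ∫⁻ a, klDiv (R ⟨n, hn⟩ (z, (p.2, a))) (R' ⟨n, hn⟩ (z, (p.2, a)))
          ∂(π ⟨n, hn⟩ (z, p.2)) ∂(prefixKernel P R π s₁ n (by omega) z) := by
  rw [map_fst_prefixKernel_succ, map_fst_prefixKernel_succ,
    klDiv_map_of_leftInverse _ _ (measurable_appendReward n) (measurable_splitReward n)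
      (leftInverse_splitReward n),
    klDiv_compProd_eq_add, klDiv_compProd_left, klDiv_compProd_right_eq_lintegral,
    Measure.lintegral_compProd (measurable_klDiv_kernel _ _)]
  rfl

variable [MeasurableSpace.CountablyGenerated S]

theorem klDiv_prefixKernel_succ (n : ℕ) (hn : n + 1 ≤ H) (z : Z) :
    klDiv (prefixKernel P R π s₁ (n + 1) hn z) (prefixKernel P' R' π s₁ (n + 1) hn z) =
      klDiv (prefixKernel P R π s₁ n (by omega) z) (prefixKernel P' R' π s₁ n (by omega) z) +
        ∫⁻ p, ∫⁻ a, klDiv ((P ⟨n, hn⟩ (z, (p.2, a))).prod (R ⟨n, hn⟩ (z, (p.2, a))))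
            ((P' ⟨n, hn⟩ (z, (p.2, a))).prod (R' ⟨n, hn⟩ (z, (p.2, a))))
          ∂(π ⟨n, hn⟩ (z, p.2)) ∂(prefixKernel P R π s₁ n (by omega) z) := by
  rw [prefixKernel_succ_apply, prefixKernel_succ_apply,
    klDiv_map_of_leftInverse _ _ (measurable_appendStep n) (measurable_splitStep n)
      (leftInverse_splitStep n),
    klDiv_compProd_eq_add, klDiv_compProd_left, klDiv_compProd_right_eq_lintegral,
    Measure.lintegral_compProd (measurable_klDiv_kernel _ _)]
  simp_rw [klDiv_prod_swap (μ₁ := R _ _), ← Kernel.prod_apply]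
  rfl

theorem klDiv_prefixKernel (n : ℕ) (hn : n ≤ H) (z : Z) :
    klDiv (prefixKernel P R π s₁ n hn z) (prefixKernel P' R' π s₁ n hn z) =
      ∑ h : Fin n, ∫⁻ p, ∫⁻ a, klDiv
            ((P (h.castLE hn) (z, (p.2, a))).prod (R (h.castLE hn) (z, (p.2, a))))
            ((P' (h.castLE hn) (z, (p.2, a))).prod (R' (h.castLE hn) (z, (p.2, a))))
          ∂(π (h.castLE hn) (z, p.2)) ∂(prefixKernel P R π s₁ h (h.2.le.trans hn) z) := by
  induction n with
  | zero => simp [prefixKernel_zero_apply]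
  | succ n ih =>
      rw [klDiv_prefixKernel_succ, ih (by omega), Fin.sum_univ_castSucc]
      rfl

theorem klDiv_map_fst_prefixKernel (z : Z) :
    klDiv ((prefixKernel P R π s₁ H le_rfl z).map Prod.fst)
        ((prefixKernel P' R' π s₁ H le_rfl z).map Prod.fst) =
      ∑ h : Fin H, ∫⁻ p, ∫⁻ a, (if (h : ℕ) + 1 < H then klDiv
            ((P h (z, (p.2, a))).prod (R h (z, (p.2, a))))
            ((P' h (z, (p.2, a))).prod (R' h (z, (p.2, a))))
            else klDiv (R h (z, (p.2, a))) (R' h (z, (p.2, a))))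
          ∂(π h (z, p.2)) ∂(prefixKernel P R π s₁ h h.2.le z) := by
  cases H with
  | zero => simp [prefixKernel_zero_apply]
  | succ n =>
      rw [klDiv_map_fst_prefixKernel_succ, klDiv_prefixKernel, Fin.sum_univ_castSucc]
      congr 1
      · refine Finset.sum_congr rfl fun h _ => ?_
        simp_rw [if_pos (show (h.castSucc : ℕ) + 1 < n + 1 by simp)]
        rfl
      · simp_rw [if_neg (show ¬((Fin.last n : Fin (n + 1)) : ℕ) + 1 < n + 1 by simp)]
        rfl

end ChainRule

end Trajectories

section ConditionalIndependence

variable {X Y V Z W : Type*} [MeasurableSpace X] [MeasurableSpace Y] [MeasurableSpace V]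
  [MeasurableSpace Z] [MeasurableSpace W] {u : Z → Z → Z} {μ : Measure (X × Z)}

/-- An operation that splices the left part of its first argument and the right part of its second
one, as `((a₁, a₂), (b₁, b₂)) ↦ (a₁, b₂)` does on a product.  Independence of the two parts can be
expressed through `u`, without types in which the parts take their values. -/
structure IsSplice (u : Z → Z → Z) : Prop where
  measurable : Measurable fun q : Z × Z => u q.1 q.2
  left : ∀ a b c, u (u a b) c = u a c
  right : ∀ a b c, u a (u b c) = u a c

theorem IsSplice.flip (hu : IsSplice u) : IsSplice (flip u) where
  measurable := hu.measurable.comp measurable_swap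
  left a b c := hu.right c b a
  right a b c := hu.left c b a

/-- The two parts of `z` that `u` splices are independent under `ν`: splicing two independent copies
of `z` does not change its law. -/
def IndepParts (u : Z → Z → Z) (ν : Measure Z) : Prop :=
  (ν.prod ν).map (fun q => u q.1 q.2) = ν

theorem IndepParts.lintegral {ν : Measure Z} [IsProbabilityMeasure ν] (h : IndepParts u ν)
    (hu : IsSplice u) {Ψ : Z → ℝ≥0∞} (hΨ : Measurable Ψ) :
    ∫⁻ z, Ψ z ∂ν = ∫⁻ a, ∫⁻ b, Ψ (u a b) ∂ν ∂ν := by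
  have hm := hu.measurable
  conv_lhs => rw [← h]
  rw [lintegral_map hΨ hm, lintegral_prod _ (by fun_prop)]

theorem IsSplice.indepParts_map_prod (hu : IsSplice u) (m₁ m₂ : Measure Z)
    [IsProbabilityMeasure m₁] [IsProbabilityMeasure m₂] :
    IndepParts u ((m₁.prod m₂).map fun q => u q.1 q.2) := by
  have hm := hu.measurable
  have : IsProbabilityMeasure ((m₁.prod m₂).map fun q => u q.1 q.2) :=
    Measure.isProbabilityMeasure_map hm.aemeasurable
  refine Measure.ext_of_lintegral _ fun F hF => ?_
  have outer (a : Z) : Measurable fun b => F (u a b) := by fun_prop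
  rw [lintegral_map hF hm, lintegral_map hF hm, lintegral_prod _ (by fun_prop),
    lintegral_prod _ (by fun_prop),
    lintegral_map (Measurable.lintegral_prod_right' (f := fun q : Z × Z => F (u q.1 q.2))
      (by fun_prop)) hm, lintegral_prod _ (Measurable.aemeasurable ?_)]
  · refine lintegral_congr fun a => ?_
    simp only [hu.left, lintegral_const, measure_univ, mul_one]
    rw [lintegral_map (outer a) hm, lintegral_prod _ (by fun_prop)]
    simp only [hu.right, lintegral_const, measure_univ, mul_one]
  · exact (Measurable.lintegral_prod_right' (f := fun q : Z × Z => F (u q.1 q.2))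
      (by fun_prop)).comp hm

/-- Under the law `μ` of a pair `(x, z)`, the two parts of `z` that `u` splices are conditionally
independent given `x`. -/
def CondIndepGiven (u : Z → Z → Z) (μ : Measure (X × Z)) : Prop :=
  ∃ (η₁ η₂ : Kernel X Z), IsMarkovKernel η₁ ∧ IsMarkovKernel η₂ ∧
    ∀ F : X × Z → ℝ≥0∞, Measurable F →
      ∫⁻ p, F p ∂μ = ∫⁻ p, ∫⁻ a, ∫⁻ b, F (p.1, u a b) ∂(η₂ p.1) ∂(η₁ p.1) ∂μ

theorem IsSplice.measurable_lintegral (hu : IsSplice u) (η₁ η₂ : Kernel X Z) [IsMarkovKernel η₁]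
    [IsMarkovKernel η₂] {F : X × Z → ℝ≥0∞} (hF : Measurable F) :
    Measurable fun p : X × W => ∫⁻ a, ∫⁻ b, F (p.1, u a b) ∂(η₂ p.1) ∂(η₁ p.1) := by
  have hm := hu.measurable
  have inner : Measurable fun q : (X × W) × Z => ∫⁻ b, F (q.1.1, u q.2 b) ∂(η₂ q.1.1) :=
    measurable_lintegral_kernel η₂ (by fun_prop) (by fun_prop)
  exact measurable_lintegral_kernel η₁ measurable_fst inner

theorem CondIndepGiven.flip (h : CondIndepGiven u μ) (hu : IsSplice u) :
    CondIndepGiven (flip u) μ := by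
  obtain ⟨η₁, η₂, h₁, h₂, hμ⟩ := h
  have := hu.measurable
  refine ⟨η₂, η₁, h₂, h₁, fun F hF => (hμ F hF).trans (lintegral_congr fun p => ?_)⟩
  exact lintegral_lintegral_swap
    (f := fun a b => F (p.1, u a b)) (by unfold Function.uncurry; fun_prop)

theorem condIndepGiven_dirac_prod {ρ : Measure Z} [IsProbabilityMeasure ρ] (hu : IsSplice u)
    (h : IndepParts u ρ) (x : X) :
    CondIndepGiven u ((Measure.dirac x).prod ρ) := by
  have := hu.measurable
  refine ⟨Kernel.const X ρ, Kernel.const X ρ, inferInstance, inferInstance, fun F hF => ?_⟩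
  rw [Measure.dirac_prod, lintegral_map hF (by fun_prop),
    lintegral_map (hu.measurable_lintegral _ _ hF) (by fun_prop)]
  simp only [Kernel.const_apply, lintegral_const, measure_univ, mul_one]
  exact h.lintegral hu (by fun_prop)

theorem CondIndepGiven.map_of_leftInverse (h : CondIndepGiven u μ) (hu : IsSplice u) {φ : X → Y}
    {ψ : Y → X} (hφ : Measurable φ) (hψ : Measurable ψ) (hψφ : Function.LeftInverse ψ φ) :
    CondIndepGiven u (μ.map fun p => (φ p.1, p.2)) := by
  obtain ⟨η₁, η₂, h₁, h₂, hμ⟩ := h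
  refine ⟨η₁.comap ψ hψ, η₂.comap ψ hψ, inferInstance, inferInstance, fun F hF => ?_⟩
  rw [lintegral_map hF (by fun_prop),
    lintegral_map (hu.measurable_lintegral _ _ hF) (by fun_prop),
    hμ (fun q => F (φ q.1, q.2)) (by fun_prop)]
  simp only [Kernel.comap_apply, hψφ _]

theorem CondIndepGiven.map_of_semiconj (h : CondIndepGiven u μ) {u' : W → W → W}
    (hu' : IsSplice u') {φ : Z → W} (hφ : Measurable φ)
    (hom : ∀ a b, φ (u a b) = u' (φ a) (φ b)) :
    CondIndepGiven u' (μ.map fun p => (p.1, φ p.2)) := by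
  obtain ⟨η₁, η₂, h₁, h₂, hμ⟩ := h
  have m₁ := Kernel.IsMarkovKernel.map η₁ hφ
  have m₂ := Kernel.IsMarkovKernel.map η₂ hφ
  have hm := hu'.measurable
  refine ⟨η₁.map φ, η₂.map φ, m₁, m₂, fun F hF => ?_⟩
  rw [lintegral_map hF (by fun_prop),
    lintegral_map (hu'.measurable_lintegral _ _ hF) (by fun_prop),
    hμ (fun q => F (q.1, φ q.2)) (by fun_prop)]
  refine lintegral_congr fun p => ?_
  have inner : Measurable fun a => ∫⁻ b, F (p.1, u' a b) ∂(η₂.map φ p.1) :=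
    Measurable.lintegral_prod_right' (f := fun q : W × W => F (p.1, u' q.1 q.2)) (by fun_prop)
  rw [Kernel.map_apply _ hφ, lintegral_map inner hφ]
  refine lintegral_congr fun a => ?_
  rw [Kernel.map_apply _ hφ, lintegral_map (by fun_prop) hφ]
  simp only [hom]

section Observe

/-- The law of `((x, y), z)` where `(x, z)` follows `μ` and `y` is drawn from `κ (z, v x)`. -/
noncomputable def observe (μ : Measure (X × Z)) (κ : Kernel (Z × V) Y) {v : X → V}
    (hv : Measurable v) : Measure ((X × Y) × Z) :=
  (μ ⊗ₘ κ.comap (fun p : X × Z => (p.2, v p.1)) (by fun_prop)).map fun q => ((q.1.1, q.2), q.1.2)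

instance [IsProbabilityMeasure μ] (κ : Kernel (Z × V) Y) [IsMarkovKernel κ] {v : X → V}
    (hv : Measurable v) : IsProbabilityMeasure (observe μ κ hv) :=
  Measure.isProbabilityMeasure_map (by fun_prop)

variable (κ : Kernel (Z × V) Y) [IsMarkovKernel κ] {v : X → V} (hv : Measurable v)

include hv in
theorem measurable_lintegral_observe {F : (X × Y) × Z → ℝ≥0∞} (hF : Measurable F) :
    Measurable fun p : X × Z => ∫⁻ y, F ((p.1, y), p.2) ∂(κ (p.2, v p.1)) :=
  measurable_lintegral_kernel κ (by fun_prop) (by fun_prop)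

theorem lintegral_observe [SFinite μ] {F : (X × Y) × Z → ℝ≥0∞} (hF : Measurable F) :
    ∫⁻ q, F q ∂(observe μ κ hv) = ∫⁻ p, ∫⁻ y, F ((p.1, y), p.2) ∂(κ (p.2, v p.1)) ∂μ := by
  rw [observe, lintegral_map hF (by fun_prop), Measure.lintegral_compProd (by fun_prop)]
  rfl

theorem lintegral_condKernel_fst [StandardBorelSpace Z] [Nonempty Z] [IsFiniteMeasure μ]
    {F : X × Z → ℝ≥0∞} (hF : Measurable F) :
    ∫⁻ p, F p ∂μ = ∫⁻ p, ∫⁻ z, F (p.1, z) ∂(μ.condKernel p.1) ∂μ := by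
  conv_lhs => rw [← μ.disintegrate μ.condKernel]
  rw [Measure.lintegral_compProd hF, Measure.fst,
    lintegral_map hF.lintegral_kernel_prod_right' measurable_fst]

/-- An observation `y` whose law depends on the left part of `z` only changes the conditional law of
that part, to the one given `(x, y)`, while the right part keeps its conditional law given `x`. -/
theorem CondIndepGiven.observe_left [IsProbabilityMeasure μ] [StandardBorelSpace Z] [Nonempty Z]
    (h : CondIndepGiven u μ) (hu : IsSplice u) (hκ : ∀ a b w, κ (u a b, w) = κ (a, w)) :
    CondIndepGiven u (observe μ κ hv) := by
  obtain ⟨η₁, η₂, _, h₂, hμ⟩ := h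
  have hm := hu.measurable
  refine ⟨(observe μ κ hv).condKernel, η₂.comap Prod.fst measurable_fst, inferInstance,
    inferInstance, fun F hF => ?_⟩
  have hG : Measurable fun q : (X × Y) × Z => ∫⁻ b, F (q.1, u q.2 b) ∂(η₂ q.1.1) :=
    measurable_lintegral_kernel η₂ (by fun_prop) (by fun_prop)
  suffices resample : ∫⁻ q, F q ∂(observe μ κ hv) =
      ∫⁻ q, ∫⁻ b, F (q.1, u q.2 b) ∂(η₂ q.1.1) ∂(observe μ κ hv) by
    rw [resample, lintegral_condKernel_fst hG]
    rfl
  rw [lintegral_observe κ hv hF, lintegral_observe κ hv hG,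
    hμ _ (measurable_lintegral_observe κ hv hF), hμ _ (measurable_lintegral_observe κ hv hG)]
  refine lintegral_congr fun p => lintegral_congr fun a => ?_
  simp only [hκ, hu.left, lintegral_const, measure_univ, mul_one]
  exact lintegral_lintegral_swap (f := fun b y => F ((p.1, y), u a b))
    (by unfold Function.uncurry; fun_prop)

/-- The law of `y` given `(z, v)` depends only on the left part or only on the right part
of `z`. -/
def FactorsThroughOne (u : Z → Z → Z) (κ : Kernel (Z × V) Y) : Prop :=
  (∀ a b w, κ (u a b, w) = κ (a, w)) ∨ ∀ a b w, κ (u a b, w) = κ (b, w)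

variable {κ}

theorem CondIndepGiven.observe [IsProbabilityMeasure μ] [StandardBorelSpace Z] [Nonempty Z]
    (h : CondIndepGiven u μ) (hu : IsSplice u) (hκ : FactorsThroughOne u κ) :
    CondIndepGiven u (observe μ κ hv) := by
  obtain left | right := hκ
  · exact h.observe_left κ hv hu left
  · exact ((h.flip hu).observe_left κ hv hu.flip fun a b => right b a).flip hu.flip

end Observe

section AdjoinParameter

/-- Splices the parts of `z` according to `u`, and takes the additional parameter from the second
argument. -/
def spliceFst (u : Z → Z → Z) (p q : Z × W) : Z × W := (u p.1 q.1, q.2)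

theorem IsSplice.spliceFst (hu : IsSplice u) :
    IsSplice (spliceFst u : Z × W → Z × W → Z × W) where
  measurable := by
    have hm := hu.measurable
    unfold BayesRL.spliceFst
    fun_prop
  left a b c := by simp only [BayesRL.spliceFst, hu.left]
  right a b c := by simp only [BayesRL.spliceFst, hu.right]

theorem FactorsThroughOne.comap_fst {κ : Kernel (Z × V) Y} (h : FactorsThroughOne u κ) :
    FactorsThroughOne (BayesRL.spliceFst u : Z × W → Z × W → Z × W)
      (κ.comap (fun z : (Z × W) × V => (z.1.1, z.2)) (by fun_prop)) :=
  h.imp (fun hκ a b => hκ a.1 b.1) fun hκ a b => hκ a.1 b.1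

/-- The law of `(x, (z, w))` where `(x, z)` follows `μ` and `w` is drawn from `τ x`. -/
noncomputable def adjoinParameter (μ : Measure (X × Z)) (τ : Kernel X W) : Measure (X × (Z × W)) :=
  (μ ⊗ₘ τ.comap Prod.fst measurable_fst).map fun q => (q.1.1, (q.1.2, q.2))

variable (τ : Kernel X W) [IsMarkovKernel τ]

instance [IsProbabilityMeasure μ] : IsProbabilityMeasure (adjoinParameter μ τ) :=
  Measure.isProbabilityMeasure_map (by fun_prop)

theorem lintegral_adjoinParameter [SFinite μ] {F : X × (Z × W) → ℝ≥0∞} (hF : Measurable F) :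
    ∫⁻ q, F q ∂(adjoinParameter μ τ) = ∫⁻ p, ∫⁻ w, F (p.1, (p.2, w)) ∂(τ p.1) ∂μ := by
  rw [adjoinParameter, lintegral_map hF (by fun_prop), Measure.lintegral_compProd (by fun_prop)]
  rfl

theorem CondIndepGiven.adjoinParameter [SFinite μ] (h : CondIndepGiven u μ) (hu : IsSplice u) :
    CondIndepGiven (spliceFst u) (adjoinParameter μ τ) := by
  obtain ⟨η₁, η₂, h₁, h₂, hμ⟩ := h
  have hm := hu.measurable
  have hs : IsSplice (BayesRL.spliceFst u : Z × W → Z × W → Z × W) := hu.spliceFst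
  have hsm := hs.measurable
  refine ⟨η₁ ×ₖ τ, η₂ ×ₖ τ, inferInstance, inferInstance, fun F hF => ?_⟩
  have hG : Measurable fun p : X × Z => ∫⁻ w, F (p.1, (p.2, w)) ∂(τ p.1) :=
    measurable_lintegral_kernel τ measurable_fst (by fun_prop)
  rw [lintegral_adjoinParameter τ hF, hμ _ hG,
    lintegral_adjoinParameter τ (hs.measurable_lintegral _ _ hF)]
  refine lintegral_congr fun p => ?_
  have inner : Measurable fun a : Z × W =>
      ∫⁻ b, F (p.1, BayesRL.spliceFst u a b) ∂((η₂ ×ₖ τ) p.1) :=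
    Measurable.lintegral_prod_right' (f := fun q : (Z × W) × (Z × W) =>
      F (p.1, BayesRL.spliceFst u q.1 q.2)) (by fun_prop)
  simp only [lintegral_const, measure_univ, mul_one]
  rw [Kernel.prod_apply η₁, lintegral_prod _ inner.aemeasurable]
  refine lintegral_congr fun a => ?_
  simp only [BayesRL.spliceFst, lintegral_const, measure_univ, mul_one]
  rw [Kernel.prod_apply, lintegral_prod _ (by fun_prop)]

end AdjoinParameter

end ConditionalIndependence

section EpisodeIndependence

variable {X Y Z S A : Type*} [MeasurableSpace X] [MeasurableSpace Y] [MeasurableSpace Z]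
  [MeasurableSpace S] [MeasurableSpace A] {H : ℕ} {u : Z → Z → Z}

/-- The law of `((x, y), z)` where `(x, z)` follows `μ` and `y` is drawn from `κ z`. -/
noncomputable def adjoinData (μ : Measure (X × Z)) (κ : Kernel Z Y) : Measure ((X × Y) × Z) :=
  observe μ (κ.prodMkRight Unit) (v := fun _ => ()) measurable_const

instance (μ : Measure (X × Z)) [IsProbabilityMeasure μ] (κ : Kernel Z Y) [IsMarkovKernel κ] :
    IsProbabilityMeasure (adjoinData μ κ) := by
  unfold adjoinData
  infer_instance

theorem lintegral_adjoinData (μ : Measure (X × Z)) [SFinite μ] (κ : Kernel Z Y) [IsMarkovKernel κ]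
    {F : (X × Y) × Z → ℝ≥0∞} (hF : Measurable F) :
    ∫⁻ q, F q ∂(adjoinData μ κ) = ∫⁻ p, ∫⁻ y, F ((p.1, y), p.2) ∂(κ p.2) ∂μ :=
  lintegral_observe _ _ hF

theorem CondIndepGiven.adjoinData_const [StandardBorelSpace Z] [Nonempty Z] {μ : Measure (X × Z)}
    [IsProbabilityMeasure μ] (h : CondIndepGiven u μ) (hu : IsSplice u) {κ : Kernel Z Y}
    [IsMarkovKernel κ] (hκ : ∀ z z', κ z = κ z') : CondIndepGiven u (adjoinData μ κ) :=
  h.observe _ hu (Or.inl fun _ _ _ => hκ _ _)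

variable (P : Fin H → Kernel (Z × (S × A)) S) (R : Fin H → Kernel (Z × (S × A)) unitInterval)
  (π : Fin H → Kernel (Z × S) A) (s₁ : S) [∀ h, IsMarkovKernel (P h)] [∀ h, IsMarkovKernel (R h)]
  [∀ h, IsMarkovKernel (π h)]

section Recursion

variable (μ : Measure (X × Z)) [IsProbabilityMeasure μ]

theorem adjoinData_prefixKernel_succ (n : ℕ) (hn : n + 1 ≤ H) :
    adjoinData μ (prefixKernel P R π s₁ (n + 1) hn) =
      (observe (observe (observe (adjoinData μ (prefixKernel P R π s₁ n (by omega)))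
        (π ⟨n, hn⟩) (v := fun x => x.2.2) (by fun_prop))
        (R ⟨n, hn⟩) (v := fun x => (x.1.2.2, x.2)) (by fun_prop))
        (P ⟨n, hn⟩) (v := fun x => (x.1.1.2.2, x.1.2)) (by fun_prop)).map
        fun q => ((q.1.1.1.1.1, appendStep ((q.1.1.1.1.2, q.1.1.1.2), (q.1.1.2, q.1.2))), q.2) := by
  refine Measure.ext_of_lintegral _ fun F hF => ?_
  have state : Measurable fun q : ((((X × (Prefix S A n × S)) × A) × unitInterval) × S) × Z =>
      F ((q.1.1.1.1.1, appendStep ((q.1.1.1.1.2, q.1.1.1.2), (q.1.1.2, q.1.2))), q.2) := by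
    fun_prop
  have reward := measurable_lintegral_observe (P ⟨n, hn⟩)
    (v := fun x : ((X × (Prefix S A n × S)) × A) × unitInterval => (x.1.1.2.2, x.1.2))
    (by fun_prop) state
  have action := measurable_lintegral_observe (R ⟨n, hn⟩)
    (v := fun x : (X × (Prefix S A n × S)) × A => (x.1.2.2, x.2)) (by fun_prop) reward
  have past := measurable_lintegral_observe (π ⟨n, hn⟩)
    (v := fun x : X × (Prefix S A n × S) => x.2.2) (by fun_prop) action
  rw [lintegral_map hF (by fun_prop), lintegral_observe _ _ state, lintegral_observe _ _ reward,
    lintegral_observe _ _ action, lintegral_adjoinData _ _ past, lintegral_adjoinData _ _ hF]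
  refine lintegral_congr fun p => ?_
  rw [lintegral_prefixKernel_succ _ _ _ _ _ _ _ (by fun_prop)]
  refine lintegral_congr fun w => lintegral_congr fun a => ?_
  rw [Kernel.prod_apply, lintegral_prod _ (Measurable.aemeasurable (by fun_prop))]

theorem adjoinData_map_fst_prefixKernel_succ (n : ℕ) (hn : n + 1 ≤ H) :
    adjoinData μ ((prefixKernel P R π s₁ (n + 1) hn).map Prod.fst) =
      (observe (observe (adjoinData μ (prefixKernel P R π s₁ n (by omega)))
        (π ⟨n, hn⟩) (v := fun x => x.2.2) (by fun_prop))
        (R ⟨n, hn⟩) (v := fun x => (x.1.2.2, x.2)) (by fun_prop)).map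
        fun q => ((q.1.1.1.1, appendReward ((q.1.1.1.2, q.1.1.2), q.1.2)), q.2) := by
  have : IsMarkovKernel ((prefixKernel P R π s₁ (n + 1) hn).map Prod.fst) :=
    Kernel.IsMarkovKernel.map _ measurable_fst
  refine Measure.ext_of_lintegral _ fun F hF => ?_
  have reward : Measurable fun q : (((X × (Prefix S A n × S)) × A) × unitInterval) × Z =>
      F ((q.1.1.1.1, appendReward ((q.1.1.1.2, q.1.1.2), q.1.2)), q.2) := by
    fun_prop
  have action := measurable_lintegral_observe (R ⟨n, hn⟩)
    (v := fun x : (X × (Prefix S A n × S)) × A => (x.1.2.2, x.2)) (by fun_prop) reward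
  have past := measurable_lintegral_observe (π ⟨n, hn⟩)
    (v := fun x : X × (Prefix S A n × S) => x.2.2) (by fun_prop) action
  rw [lintegral_map hF (by fun_prop), lintegral_observe _ _ reward, lintegral_observe _ _ action,
    lintegral_adjoinData _ _ past, lintegral_adjoinData _ _ hF]
  refine lintegral_congr fun p => ?_
  rw [Kernel.map_apply _ measurable_fst, lintegral_map (by fun_prop) measurable_fst,
    lintegral_prefixKernel_succ _ _ _ _ _ _ _ (by fun_prop)]
  refine lintegral_congr fun w => lintegral_congr fun a => ?_
  change ∫⁻ q : unitInterval × S, F ((p.1, appendReward ((w, a), q.1)), p.2) ∂_ = _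
  rw [Kernel.prod_apply, lintegral_prod _ (Measurable.aemeasurable (by fun_prop))]
  simp only [lintegral_const, measure_univ, mul_one]

end Recursion

variable [StandardBorelSpace Z] [Nonempty Z] {μ : Measure (X × Z)} [IsProbabilityMeasure μ]

theorem CondIndepGiven.adjoinData_prefixKernel (h : CondIndepGiven u μ) (hu : IsSplice u)
    (hP : ∀ h, FactorsThroughOne u (P h)) (hR : ∀ h, FactorsThroughOne u (R h))
    (hπ : ∀ h, FactorsThroughOne u (π h)) (n : ℕ) (hn : n ≤ H) :
    CondIndepGiven u (adjoinData μ (prefixKernel P R π s₁ n hn)) := by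
  induction n with
  | zero => exact h.adjoinData_const hu fun z z' => by simp only [prefixKernel_zero_apply]
  | succ n ih =>
      rw [adjoinData_prefixKernel_succ]
      have split : Measurable fun y : X × (Prefix S A (n + 1) × S) => splitStep y.2 :=
        (measurable_splitStep n).comp measurable_snd
      refine ((((ih (by omega)).observe _ hu (hπ _)).observe _ hu (hR _)).observe _ hu
        (hP _)).map_of_leftInverse hu
        (φ := fun x => (x.1.1.1.1, appendStep ((x.1.1.1.2, x.1.1.2), (x.1.2, x.2))))
        (ψ := fun y => ((((y.1, (splitStep y.2).1.1), (splitStep y.2).1.2),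
          (splitStep y.2).2.1), (splitStep y.2).2.2)) (by fun_prop)
        ((((measurable_fst.prodMk split.fst.fst).prodMk split.fst.snd).prodMk
          split.snd.fst).prodMk split.snd.snd) fun x => ?_
      simp only [leftInverse_splitStep n _]

theorem CondIndepGiven.adjoinData_map_fst_prefixKernel (h : CondIndepGiven u μ) (hu : IsSplice u)
    (hP : ∀ h, FactorsThroughOne u (P h)) (hR : ∀ h, FactorsThroughOne u (R h))
    (hπ : ∀ h, FactorsThroughOne u (π h)) (n : ℕ) (hn : n ≤ H) :
    CondIndepGiven u (adjoinData μ ((prefixKernel P R π s₁ n hn).map Prod.fst)) := by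
  have hm : IsMarkovKernel ((prefixKernel P R π s₁ n hn).map Prod.fst) :=
    Kernel.IsMarkovKernel.map _ measurable_fst
  cases n with
  | zero =>
      refine h.adjoinData_const hu fun z z' => ?_
      simp only [Kernel.map_apply _ measurable_fst, prefixKernel_zero_apply]
  | succ n =>
      rw [adjoinData_map_fst_prefixKernel_succ]
      have split : Measurable fun y : X × Prefix S A (n + 1) => splitReward y.2 :=
        (measurable_splitReward n).comp measurable_snd
      refine (((h.adjoinData_prefixKernel P R π s₁ hu hP hR hπ n (by omega)).observe _ hu
        (hπ _)).observe _ hu (hR _)).map_of_leftInverse hu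
        (φ := fun x => (x.1.1.1, appendReward ((x.1.1.2, x.1.2), x.2)))
        (ψ := fun y => (((y.1, (splitReward y.2).1.1), (splitReward y.2).1.2),
          (splitReward y.2).2)) (by fun_prop)
        (((measurable_fst.prodMk split.fst.fst).prodMk split.fst.snd).prodMk split.snd)
        fun x => ?_
      simp only [leftInverse_splitReward n _]

end EpisodeIndependence

namespace Model

variable {S A : Type*} [MeasurableSpace S] [MeasurableSpace A] {H : ℕ}
  {ΘP ΘR : Fin H → Type*} [∀ h, MeasurableSpace (ΘP h)] [∀ h, MeasurableSpace (ΘR h)]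
  {M : Model S A ΘP ΘR} {Pi : Set (Policy S A H)} (σ : M.OptimalSelector Pi)

section Data

variable [∀ h, StandardBorelSpace (ΘP h)] [∀ h, StandardBorelSpace (ΘR h)]
  [∀ h, Nonempty (ΘP h)] [∀ h, Nonempty (ΘR h)]
  {O : Type*} [MeasurableSpace O] (obs : Traj S A H → O) (hobs : Measurable obs)
  (ρ : Measure (Param ΘP ΘR)) [IsProbabilityMeasure ρ]

/-- The joint law of the data of `n` episodes and of the environment, if the latter follows `ρ`. -/
noncomputable def jointData (ρ : Measure (Param ΘP ΘR)) (n : ℕ) :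
    Measure ((Fin n → O) × Param ΘP ΘR) :=
  (ρ ⊗ₘ data σ obs hobs n).map Prod.swap

instance (n : ℕ) : IsProbabilityMeasure (jointData σ obs hobs ρ n) :=
  Measure.isProbabilityMeasure_map (by fun_prop)

theorem lintegral_jointData (n : ℕ) {F : (Fin n → O) × Param ΘP ΘR → ℝ≥0∞} (hF : Measurable F) :
    ∫⁻ q, F q ∂(jointData σ obs hobs ρ n) = ∫⁻ θ, ∫⁻ D, F (D, θ) ∂(data σ obs hobs n θ) ∂ρ := by
  rw [jointData, lintegral_map hF (by fun_prop), Measure.lintegral_compProd (by fun_prop)]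
  rfl

theorem jointData_zero : jointData σ obs hobs ρ 0 = (Measure.dirac Fin.elim0).prod ρ := by
  refine Measure.ext_of_lintegral _ fun F hF => ?_
  have no_data (θ : Param ΘP ΘR) : data σ obs hobs 0 θ = Measure.dirac Fin.elim0 := by
    rw [data, dataAux, Kernel.const_apply]
  rw [lintegral_jointData _ _ _ _ _ hF, Measure.dirac_prod, lintegral_map hF (by fun_prop)]
  refine lintegral_congr fun θ => ?_
  rw [no_data, lintegral_dirac' _ (by fun_prop)]

theorem lintegral_nextRecord {X : Type*} [MeasurableSpace X] (κ : Kernel (Param ΘP ΘR) X)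
    [IsMarkovKernel κ] (θ : Param ΘP ΘR) (x : X) {F : O → ℝ≥0∞} (hF : Measurable F) :
    ∫⁻ o, F o ∂(nextRecord σ obs hobs κ (θ, x)) =
      ∫⁻ θ', ∫⁻ o, F o ∂(record σ obs hobs (θ, θ')) ∂(posterior κ M.prior x) := by
  rw [nextRecord, Kernel.snd_apply, lintegral_map hF measurable_snd,
    Kernel.lintegral_compProd _ _ _ (by fun_prop)]
  rfl

theorem lintegral_data_succ (n : ℕ) (θ : Param ΘP ΘR) {F : (Fin (n + 1) → O) → ℝ≥0∞}
    (hF : Measurable F) :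
    ∫⁻ D, F D ∂(data σ obs hobs (n + 1) θ) =
      ∫⁻ D, ∫⁻ θ', ∫⁻ o, F (Fin.snoc D o) ∂(record σ obs hobs (θ, θ'))
        ∂(posterior (data σ obs hobs n) M.prior D) ∂(data σ obs hobs n θ) := by
  have snoc : Measurable fun q : (Fin n → O) × O => F (Fin.snoc q.1 q.2) :=
    hF.comp (measurable_snoc n)
  have unfold_data : data σ obs hobs (n + 1) =
      (data σ obs hobs n ⊗ₖ nextRecord σ obs hobs (data σ obs hobs n)).map
        (fun p => (Fin.snoc p.1 p.2 : Fin (n + 1) → O)) := rfl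
  rw [unfold_data, Kernel.map_apply _ (measurable_snoc n), lintegral_map hF (measurable_snoc n),
    Kernel.lintegral_compProd _ _ _ snoc]
  exact lintegral_congr fun D =>
    lintegral_nextRecord σ obs hobs _ θ D (snoc.comp measurable_prodMk_left)

theorem jointData_succ (n : ℕ) :
    jointData σ obs hobs ρ (n + 1) =
      (adjoinData (adjoinParameter (jointData σ obs hobs ρ n)
        (posterior (data σ obs hobs n) M.prior)) (record σ obs hobs)).map
        fun q => (Fin.snoc q.1.1 q.1.2, q.2.1) := by
  have msnoc : Measurable fun q : ((Fin n → O) × O) × (Param ΘP ΘR × Param ΘP ΘR) =>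
      ((Fin.snoc q.1.1 q.1.2 : Fin (n + 1) → O), q.2.1) :=
    ((measurable_snoc n).comp measurable_fst).prodMk (by fun_prop)
  refine Measure.ext_of_lintegral _ fun F hF => ?_
  have msnocF : Measurable fun q : ((Fin n → O) × O) × (Param ΘP ΘR × Param ΘP ΘR) =>
      F (Fin.snoc q.1.1 q.1.2, q.2.1) := hF.comp msnoc
  have mrecord : Measurable fun p : (Fin n → O) × (Param ΘP ΘR × Param ΘP ΘR) =>
      ∫⁻ o, F (Fin.snoc p.1 o, p.2.1) ∂(record σ obs hobs p.2) :=
    measurable_lintegral_kernel (record σ obs hobs) measurable_snd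
      (msnocF.comp (g := fun q : ((Fin n → O) × O) × (Param ΘP ΘR × Param ΘP ΘR) =>
        F (Fin.snoc q.1.1 q.1.2, q.2.1))
        (f := fun q : ((Fin n → O) × (Param ΘP ΘR × Param ΘP ΘR)) × O => ((q.1.1, q.2), q.1.2))
        (by fun_prop))
  have mposterior : Measurable fun p : (Fin n → O) × Param ΘP ΘR =>
      ∫⁻ θ', ∫⁻ o, F (Fin.snoc p.1 o, p.2) ∂(record σ obs hobs (p.2, θ'))
        ∂(posterior (data σ obs hobs n) M.prior p.1) :=
    measurable_lintegral_kernel _ measurable_fst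
      (mrecord.comp (f := fun q : ((Fin n → O) × Param ΘP ΘR) × Param ΘP ΘR =>
        (q.1.1, (q.1.2, q.2))) (by fun_prop))
  rw [lintegral_map hF msnoc, lintegral_adjoinData _ _ msnocF, lintegral_adjoinParameter _ mrecord,
    lintegral_jointData _ _ _ _ _ mposterior, lintegral_jointData _ _ _ _ _ hF]
  exact lintegral_congr fun θ => lintegral_data_succ σ obs hobs n θ (by fun_prop)

variable (u : Param ΘP ΘR → Param ΘP ΘR → Param ΘP ΘR)

/-- Recording one episode preserves the conditional independence, given the data, of the two parts
of the environment that `u` splices; the policy of the episode may depend on the second part. -/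
def RecordPreservesIndep : Prop :=
  ∀ (n : ℕ) (μ : Measure ((Fin n → O) × (Param ΘP ΘR × Param ΘP ΘR))) [IsProbabilityMeasure μ],
    CondIndepGiven (spliceFst u) μ →
      CondIndepGiven (spliceFst u) (adjoinData μ (record σ obs hobs))

variable {u}

theorem condIndepGiven_jointData (hu : IsSplice u) (h : IndepParts u ρ)
    (hrec : RecordPreservesIndep σ obs hobs u) (n : ℕ) :
    CondIndepGiven u (jointData σ obs hobs ρ n) := by
  induction n with
  | zero =>
      rw [jointData_zero]
      exact condIndepGiven_dirac_prod hu h _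
  | succ n ih =>
      have forget := (hrec n _ (ih.adjoinParameter
        (posterior (data σ obs hobs n) M.prior) hu)).map_of_semiconj hu measurable_fst
        fun _ _ => rfl
      have snoc := forget.map_of_leftInverse hu
        (φ := fun p : (Fin n → O) × O => (Fin.snoc p.1 p.2 : Fin (n + 1) → O))
        (ψ := fun w => (Fin.init w, w (Fin.last n))) (measurable_snoc n)
        (by unfold Fin.init; fun_prop) fun p => by simp
      rw [jointData_succ]
      rwa [Measure.map_map (g := fun p : ((Fin n → O) × O) × Param ΘP ΘR =>
        ((Fin.snoc p.1.1 p.1.2 : Fin (n + 1) → O), p.2))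
        (((measurable_snoc n).comp measurable_fst).prodMk measurable_snd) (by fun_prop)] at snoc

end Data

section Record

variable {u : Param ΘP ΘR → Param ΘP ΘR → Param ΘP ΘR}

theorem factorsThroughOne_selector (h : Fin H) :
    FactorsThroughOne (spliceFst u)
      ((σ.kernel h).comap (fun z : (Param ΘP ΘR × Param ΘP ΘR) × S => (z.1.2, z.2))
        (by fun_prop)) :=
  Or.inr fun _ _ _ => rfl

theorem record_id : record σ id measurable_id = episode σ := by
  rw [record, Kernel.deterministic_comp_eq_map, Kernel.map_id]

theorem record_fst : record σ Prod.fst measurable_fst = (episode σ).map Prod.fst := by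
  rw [record, Kernel.deterministic_comp_eq_map]

variable [∀ h, StandardBorelSpace (ΘP h)] [∀ h, StandardBorelSpace (ΘR h)]
  [∀ h, Nonempty (ΘP h)] [∀ h, Nonempty (ΘR h)]

theorem recordPreservesIndep_id (hu : IsSplice u) (hP : ∀ h, FactorsThroughOne u (M.transΘ h))
    (hR : ∀ h, FactorsThroughOne u (M.rewΘ h)) : RecordPreservesIndep σ id measurable_id u := by
  intro n μ _ h
  rw [record_id]
  exact h.adjoinData_prefixKernel _ _ _ _ hu.spliceFst
    (fun j => (hP j).comap_fst) (fun j => (hR j).comap_fst)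
    (fun j => factorsThroughOne_selector σ j) H le_rfl

theorem recordPreservesIndep_fst (hu : IsSplice u) (hP : ∀ h, FactorsThroughOne u (M.transΘ h))
    (hR : ∀ h, FactorsThroughOne u (M.rewΘ h)) :
    RecordPreservesIndep σ Prod.fst measurable_fst u := by
  intro n μ _ h
  rw [record_fst]
  exact h.adjoinData_map_fst_prefixKernel _ _ _ _ hu.spliceFst
    (fun j => (hP j).comap_fst) (fun j => (hR j).comap_fst)
    (fun j => factorsThroughOne_selector σ j) H le_rfl

end Record

end Model

section Splicing

variable {H : ℕ} {ΘP ΘR : Fin H → Type*}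

open Classical in
/-- The parameters `θ`, with those whose index lies in `I` replaced by the ones of `t`.  The index
`.inl h` stands for the transition and `.inr h` for the reward parameter of layer `h`. -/
noncomputable def splice (I : Set (Fin H ⊕ Fin H)) (θ t : Param ΘP ΘR) : Param ΘP ΘR :=
  (fun h => if .inl h ∈ I then t.1 h else θ.1 h, fun h => if .inr h ∈ I then t.2 h else θ.2 h)

/-- The indices of the transition and of the reward parameter of layer `h`. -/
def layer (h : Fin H) : Set (Fin H ⊕ Fin H) := {.inl h, .inr h}

theorem inl_mem_layer {h j : Fin H} : .inl j ∈ layer h ↔ j = h := by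
  simp [layer]

theorem inr_mem_layer {h j : Fin H} : .inr j ∈ layer h ↔ j = h := by
  simp [layer]

section Apply

variable {I : Set (Fin H ⊕ Fin H)} (θ t : Param ΘP ΘR) {h : Fin H}

theorem splice_fst_of_mem (hI : .inl h ∈ I) : (splice I θ t).1 h = t.1 h :=
  if_pos hI

theorem splice_fst_of_notMem (hI : .inl h ∉ I) : (splice I θ t).1 h = θ.1 h :=
  if_neg hI

theorem splice_snd_of_mem (hI : .inr h ∈ I) : (splice I θ t).2 h = t.2 h :=
  if_pos hI

theorem splice_snd_of_notMem (hI : .inr h ∉ I) : (splice I θ t).2 h = θ.2 h :=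
  if_neg hI

end Apply

theorem splice_preimage_pi_prod_pi (I : Set (Fin H ⊕ Fin H)) [DecidablePred (· ∈ I)]
    (s : ∀ h, Set (ΘP h)) (t : ∀ h, Set (ΘR h)) :
    (fun q : Param ΘP ΘR × Param ΘP ΘR => splice I q.1 q.2) ⁻¹'
        (Set.univ.pi s ×ˢ Set.univ.pi t) =
      ((Set.univ.pi fun h => if .inl h ∈ I then Set.univ else s h) ×ˢ
        (Set.univ.pi fun h => if .inr h ∈ I then Set.univ else t h)) ×ˢ
      ((Set.univ.pi fun h => if .inl h ∈ I then s h else Set.univ) ×ˢ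
        (Set.univ.pi fun h => if .inr h ∈ I then t h else Set.univ)) := by
  ext q
  simp only [Set.mem_preimage, Set.mem_prod, Set.mem_univ_pi, splice]
  grind

variable [∀ h, MeasurableSpace (ΘP h)] [∀ h, MeasurableSpace (ΘR h)]

theorem isSplice_splice (I : Set (Fin H ⊕ Fin H)) :
    IsSplice (splice I : Param ΘP ΘR → Param ΘP ΘR → Param ΘP ΘR) where
  measurable := by
    refine (measurable_pi_iff.2 fun h => ?_).prodMk (measurable_pi_iff.2 fun h => ?_)
    · exact Measurable.ite (.const _) (by fun_prop) (by fun_prop)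
    · exact Measurable.ite (.const _) (by fun_prop) (by fun_prop)
  left a b c := by
    refine Prod.ext (funext fun h => ?_) (funext fun h => ?_) <;> simp only [splice] <;>
      split_ifs <;> rfl
  right a b c := by
    refine Prod.ext (funext fun h => ?_) (funext fun h => ?_) <;> simp only [splice] <;>
      split_ifs <;> rfl

/-- All transition and reward parameters of all layers are independent of each other: their joint
law is invariant under every splicing of two independent copies. -/
def CoordIndep (ν : Measure (Param ΘP ΘR)) : Prop :=
  ∀ I, IndepParts (splice I) ν

theorem prod_pi_pi_eq {a : ∀ h, Measure (ΘP h)} {b : ∀ h, Measure (ΘR h)} [∀ h, SigmaFinite (a h)]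
    [∀ h, SigmaFinite (b h)] {ν : Measure (Param ΘP ΘR)}
    (hν : ∀ s t, (∀ h, MeasurableSet (s h)) → (∀ h, MeasurableSet (t h)) →
      ν (Set.univ.pi s ×ˢ Set.univ.pi t) = (∏ h, a h (s h)) * ∏ h, b h (t h)) :
    (Measure.pi a).prod (Measure.pi b) = ν := by
  refine Measure.prod_eq_generateFrom generateFrom_pi generateFrom_pi isPiSystem_pi isPiSystem_pi
    (Measure.FiniteSpanningSetsIn.pi fun h => (a h).toFiniteSpanningSetsIn)
    (Measure.FiniteSpanningSetsIn.pi fun h => (b h).toFiniteSpanningSetsIn) ?_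
  rintro _ ⟨s, hs, rfl⟩ _ ⟨t, ht, rfl⟩
  rw [hν s t (fun h => hs h trivial) (fun h => ht h trivial), Measure.pi_pi, Measure.pi_pi]

theorem coordIndep_prod_pi_pi (a : ∀ h, Measure (ΘP h)) (b : ∀ h, Measure (ΘR h))
    [∀ h, IsProbabilityMeasure (a h)] [∀ h, IsProbabilityMeasure (b h)] :
    CoordIndep ((Measure.pi a).prod (Measure.pi b)) := by
  classical
  intro I
  refine (prod_pi_pi_eq fun s t hs ht => ?_).symm
  rw [Measure.map_apply (isSplice_splice I).measurable
    ((MeasurableSet.univ_pi hs).prod (MeasurableSet.univ_pi ht)), splice_preimage_pi_prod_pi]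
  simp only [Measure.prod_prod, Measure.pi_pi, apply_ite, measure_univ]
  rw [mul_mul_mul_comm, ← Finset.prod_mul_distrib, ← Finset.prod_mul_distrib]
  simp only [ite_mul, mul_ite, one_mul, mul_one]
  congr! 3 <;> split_ifs <;> rfl

theorem CoordIndep.of_layers {ν : Measure (Param ΘP ΘR)} [IsProbabilityMeasure ν]
    (hlayers : iIndepFun (fun h (θ : Param ΘP ΘR) => (θ.1 h, θ.2 h)) ν)
    (hlayer : ∀ h, IndepFun (fun θ : Param ΘP ΘR => θ.1 h) (fun θ => θ.2 h) ν) :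
    CoordIndep ν := by
  have (h : Fin H) : IsProbabilityMeasure (ν.map fun θ => θ.1 h) :=
    Measure.isProbabilityMeasure_map (by fun_prop)
  have (h : Fin H) : IsProbabilityMeasure (ν.map fun θ => θ.2 h) :=
    Measure.isProbabilityMeasure_map (by fun_prop)
  suffices product : (Measure.pi fun h => ν.map fun θ => θ.1 h).prod
      (Measure.pi fun h => ν.map fun θ => θ.2 h) = ν by
    rw [← product]
    exact coordIndep_prod_pi_pi _ _
  refine prod_pi_pi_eq fun s t hs ht => ?_
  have box : Set.univ.pi s ×ˢ Set.univ.pi t =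
      ⋂ h ∈ Finset.univ, (fun θ : Param ΘP ΘR => (θ.1 h, θ.2 h)) ⁻¹' (s h ×ˢ t h) := by
    ext θ
    simp only [Set.mem_prod, Set.mem_univ_pi, Finset.mem_univ, Set.iInter_true, Set.mem_iInter,
      Set.mem_preimage, forall_and]
  rw [box, hlayers.measure_inter_preimage_eq_mul Finset.univ fun h _ => (hs h).prod (ht h),
    ← Finset.prod_mul_distrib]
  refine Finset.prod_congr rfl fun h _ => ?_
  rw [Measure.map_apply (by fun_prop) (hs h), Measure.map_apply (by fun_prop) (ht h),
    ← (hlayer h).measure_inter_preimage_eq_mul _ _ (hs h) (ht h)]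
  rfl

end Splicing

section Posterior

variable {Ω X : Type*} [MeasurableSpace Ω] [StandardBorelSpace Ω] [Nonempty Ω] [MeasurableSpace X]
  (κ : Kernel Ω X) [IsMarkovKernel κ] (ρ : Measure Ω) [IsProbabilityMeasure ρ] {C : Set Ω}

theorem lintegral_posterior {G : X × Ω → ℝ≥0∞} (hG : Measurable G) :
    ∫⁻ x, ∫⁻ θ, G (x, θ) ∂(posterior κ ρ x) ∂(κ ∘ₘ ρ) = ∫⁻ θ, ∫⁻ x, G (x, θ) ∂(κ θ) ∂ρ := by
  rw [← Measure.lintegral_compProd hG, compProd_posterior_eq_map_swap,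
    lintegral_map hG measurable_swap, Measure.lintegral_compProd (by fun_prop)]
  rfl

theorem lintegral_posterior_restrict (hC : MeasurableSet C) (hC0 : ρ C ≠ 0) {G : X × Ω → ℝ≥0∞}
    (hG : Measurable G) :
    ∫⁻ x, ∫⁻ θ in C, G (x, θ) ∂(posterior κ ρ x) ∂(κ ∘ₘ ρ) =
      ρ C * ∫⁻ x, ∫⁻ θ, G (x, θ) ∂(posterior κ (ρ[|C]) x) ∂(κ ∘ₘ ρ[|C]) := by
  have := cond_isProbabilityMeasure hC0
  have restrict_eq : ρ.restrict C = ρ C • ρ[|C] := by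
    rw [ProbabilityTheory.cond, smul_smul, ENNReal.mul_inv_cancel hC0 (measure_ne_top _ _),
      one_smul]
  have indicator_inner (θ : Ω) : ∫⁻ x, (Prod.snd ⁻¹' C).indicator G (x, θ) ∂(κ θ) =
      C.indicator (fun θ => ∫⁻ x, G (x, θ) ∂(κ θ)) θ := by
    by_cases hθ : θ ∈ C <;> simp [Set.indicator, hθ]
  rw [lintegral_posterior κ _ hG, ← smul_eq_mul, ← lintegral_smul_measure, ← restrict_eq,
    ← lintegral_indicator hC, ← lintegral_congr indicator_inner,
    ← lintegral_posterior κ ρ (hG.indicator (measurable_snd hC))]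
  refine lintegral_congr fun x => ?_
  rw [← lintegral_indicator hC]
  rfl

theorem ae_cond_posterior_eq (hC : MeasurableSet C) (hC0 : ρ C ≠ 0) :
    ∀ᵐ x ∂(κ ∘ₘ ρ), posterior κ ρ x C ≠ 0 →
      (posterior κ ρ x)[|C] = posterior κ (ρ[|C]) x := by
  have := cond_isProbabilityMeasure hC0
  let restricted : Kernel X Ω := (posterior κ ρ).restrict hC
  let rescaled : Kernel X Ω := (restricted ×ₖ posterior κ (ρ[|C])).snd
  have rescaled_apply (x : X) :
      rescaled x = posterior κ ρ x C • posterior κ (ρ[|C]) x := by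
    rw [Kernel.snd_apply, Kernel.prod_apply, Measure.map_snd_prod, Kernel.restrict_apply,
      Measure.restrict_apply_univ]
  have ae_eq : restricted =ᵐ[κ ∘ₘ ρ] rescaled := by
    refine Kernel.ae_eq_of_compProd_eq (Measure.ext_of_lintegral _ fun F hF => ?_)
    have hF' : Measurable fun x => ∫⁻ θ, F (x, θ) ∂(posterior κ (ρ[|C]) x) :=
      hF.lintegral_kernel_prod_right'
    rw [Measure.lintegral_compProd hF, Measure.lintegral_compProd hF]
    simp only [rescaled_apply, lintegral_smul_measure, smul_eq_mul, restricted,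
      Kernel.restrict_apply]
    rw [lintegral_posterior_restrict κ ρ hC hC0 hF]
    have resample := lintegral_posterior_restrict κ ρ hC hC0 (hF'.comp measurable_fst)
    simp only [Function.comp_apply, lintegral_const, measure_univ, mul_one,
      Measure.restrict_apply_univ] at resample
    rw [← resample]
    simp only [mul_comm]
  filter_upwards [ae_eq] with x hx hxC
  rw [ProbabilityTheory.cond, ← Kernel.restrict_apply _ hC]
  change _ • restricted x = _
  rw [hx, rescaled_apply, smul_smul, ENNReal.inv_mul_cancel hxC (measure_ne_top _ _), one_smul]

theorem ae_posterior_of_ae_cond (hC : MeasurableSet C) (hC0 : ρ C ≠ 0) {p : X → Prop}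
    (h : ∀ᵐ x ∂(κ ∘ₘ ρ[|C]), p x) : ∀ᵐ x ∂(κ ∘ₘ ρ), posterior κ ρ x C ≠ 0 → p x := by
  have := cond_isProbabilityMeasure hC0
  obtain ⟨N, hpN, hN, hN0⟩ := exists_measurable_superset_of_null (ae_iff.1 h)
  have null := lintegral_posterior_restrict κ ρ hC hC0
    (G := fun q => N.indicator 1 q.1) ((measurable_one.indicator hN).comp measurable_fst)
  simp only [lintegral_const, measure_univ, mul_one, lintegral_indicator_one hN, hN0,
    mul_zero, Measure.restrict_apply_univ] at null
  have measurable_mass : Measurable fun x => N.indicator 1 x * posterior κ ρ x C :=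
    (measurable_one.indicator hN).mul (Kernel.measurable_coe _ hC)
  rw [lintegral_eq_zero_iff measurable_mass] at null
  filter_upwards [null] with x hx hxC
  by_contra hpx
  have hxN : x ∈ N := hpN hpx
  simp [hxN, hxC] at hx

theorem ae_ae_posterior_of_ae {p : Ω → Prop} (h : ∀ᵐ θ ∂ρ, p θ) :
    ∀ᵐ x ∂(κ ∘ₘ ρ), ∀ᵐ θ ∂(posterior κ ρ x), p θ := by
  rw [← posterior_comp_self (κ := κ) (μ := ρ)] at h
  exact Measure.ae_ae_of_ae_comp h

variable {κ ρ} {u : Ω → Ω → Ω}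

theorem CondIndepGiven.ae_indepParts_posterior
    (h : CondIndepGiven u ((ρ ⊗ₘ κ).map Prod.swap)) (hu : IsSplice u) :
    ∀ᵐ x ∂(κ ∘ₘ ρ), IndepParts u (posterior κ ρ x) := by
  obtain ⟨η₁, η₂, _, _, hF⟩ := h
  have hm := hu.measurable
  let τ : Kernel X Ω := (η₁ ×ₖ η₂).map fun q => u q.1 q.2
  have : IsMarkovKernel τ := Kernel.IsMarkovKernel.map _ hm
  have lintegral_τ (x : X) {G : Ω → ℝ≥0∞} (hG : Measurable G) :
      ∫⁻ θ, G θ ∂(τ x) = ∫⁻ a, ∫⁻ b, G (u a b) ∂(η₂ x) ∂(η₁ x) := by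
    rw [Kernel.map_apply _ hm, lintegral_map hG hm, Kernel.prod_apply,
      lintegral_prod _ (by fun_prop)]
  have joint : (κ ∘ₘ ρ) ⊗ₘ τ = (ρ ⊗ₘ κ).map Prod.swap := by
    refine Measure.ext_of_lintegral _ fun F hFm => ?_
    have fst_law : ((ρ ⊗ₘ κ).map Prod.swap).fst = κ ∘ₘ ρ := by
      rw [Measure.fst_map_swap, Measure.snd_compProd]
    rw [hF F hFm, Measure.lintegral_compProd hFm, ← fst_law, Measure.fst,
      lintegral_map hFm.lintegral_kernel_prod_right' measurable_fst]
    exact lintegral_congr fun p => lintegral_τ p.1 (by fun_prop)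
  filter_upwards [ae_eq_posterior_of_compProd_eq joint] with x hx
  rw [← hx, Kernel.map_apply _ hm, Kernel.prod_apply]
  exact hu.indepParts_map_prod _ _

end Posterior

namespace Model

section PosteriorIndependence

variable {S A : Type*} [MeasurableSpace S] [MeasurableSpace A] {H : ℕ}
  {ΘP ΘR : Fin H → Type*} [∀ h, MeasurableSpace (ΘP h)] [∀ h, MeasurableSpace (ΘR h)]
  {M : Model S A ΘP ΘR}

section Kernels

variable (I : Set (Fin H ⊕ Fin H)) (h : Fin H) (θ t : Param ΘP ΘR) (x : S × A)

theorem transΘ_splice_of_mem (hI : .inl h ∈ I) :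
    M.transΘ h (splice I θ t, x) = M.transΘ h (t, x) := by
  rw [transΘ, Kernel.comap_apply, Kernel.comap_apply, splice_fst_of_mem θ t hI]

theorem transΘ_splice_of_notMem (hI : .inl h ∉ I) :
    M.transΘ h (splice I θ t, x) = M.transΘ h (θ, x) := by
  rw [transΘ, Kernel.comap_apply, Kernel.comap_apply, splice_fst_of_notMem θ t hI]

theorem rewΘ_splice_of_mem (hI : .inr h ∈ I) : M.rewΘ h (splice I θ t, x) = M.rewΘ h (t, x) := by
  rw [rewΘ, Kernel.comap_apply, Kernel.comap_apply, splice_snd_of_mem θ t hI]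

theorem rewΘ_splice_of_notMem (hI : .inr h ∉ I) :
    M.rewΘ h (splice I θ t, x) = M.rewΘ h (θ, x) := by
  rw [rewΘ, Kernel.comap_apply, Kernel.comap_apply, splice_snd_of_notMem θ t hI]

theorem factorsThroughOne_transΘ : FactorsThroughOne (splice I) (M.transΘ h) := by
  by_cases hI : .inl h ∈ I
  · exact Or.inr fun a b x => transΘ_splice_of_mem I h a b x hI
  · exact Or.inl fun a b x => transΘ_splice_of_notMem I h a b x hI

theorem factorsThroughOne_rewΘ : FactorsThroughOne (splice I) (M.rewΘ h) := by
  by_cases hI : .inr h ∈ I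
  · exact Or.inr fun a b x => rewΘ_splice_of_mem I h a b x hI
  · exact Or.inl fun a b x => rewΘ_splice_of_notMem I h a b x hI

end Kernels

variable [∀ h, StandardBorelSpace (ΘP h)] [∀ h, StandardBorelSpace (ΘR h)]
  [∀ h, Nonempty (ΘP h)] [∀ h, Nonempty (ΘR h)] {Pi : Set (Policy S A H)}
  {σ : M.OptimalSelector Pi} {O : Type*} [MeasurableSpace O] {obs : Traj S A H → O}
  {hobs : Measurable obs}

theorem ae_coordIndep_posterior (hrec : ∀ I, RecordPreservesIndep σ obs hobs (splice I)) (n : ℕ)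
    {ρ : Measure (Param ΘP ΘR)} [IsProbabilityMeasure ρ] (hρ : CoordIndep ρ) :
    ∀ᵐ D ∂(data σ obs hobs n ∘ₘ ρ), CoordIndep (posterior (data σ obs hobs n) ρ D) :=
  ae_all_iff.2 fun I => (condIndepGiven_jointData σ obs hobs ρ (isSplice_splice I) (hρ I)
    (hrec I) n).ae_indepParts_posterior (isSplice_splice I)

theorem ae_coordIndep_post (hrec : ∀ I, RecordPreservesIndep σ obs hobs (splice I)) (n : ℕ) :
    ∀ᵐ D ∂(dataLaw σ obs hobs n), CoordIndep (post σ obs hobs n D) :=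
  ae_coordIndep_posterior hrec n (coordIndep_prod_pi_pi M.priorP M.priorR)

theorem ae_ae_post_of_ae_prior (n : ℕ) {p : Param ΘP ΘR → Prop} (h : ∀ᵐ θ ∂M.prior, p θ) :
    ∀ᵐ D ∂(dataLaw σ obs hobs n), ∀ᵐ θ ∂(post σ obs hobs n D), p θ :=
  ae_ae_posterior_of_ae (data σ obs hobs n) M.prior h

theorem ae_coordIndep_cond_post (hrec : ∀ I, RecordPreservesIndep σ obs hobs (splice I)) (n : ℕ)
    {C : Set (Param ΘP ΘR)} (hC : MeasurableSet C)
    (h : M.prior C ≠ 0 → CoordIndep (M.prior[|C])) :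
    ∀ᵐ D ∂(dataLaw σ obs hobs n), post σ obs hobs n D C ≠ 0 →
      CoordIndep ((post σ obs hobs n D)[|C]) := by
  by_cases hC0 : M.prior C = 0
  · filter_upwards [ae_ae_post_of_ae_prior n (measure_eq_zero_iff_ae_notMem.1 hC0)] with D hD hD0
    exact absurd (measure_eq_zero_iff_ae_notMem.2 hD) hD0
  · have := cond_isProbabilityMeasure hC0
    filter_upwards [ae_cond_posterior_eq (data σ obs hobs n) M.prior hC hC0,
      ae_posterior_of_ae_cond (data σ obs hobs n) M.prior hC hC0
        (ae_coordIndep_posterior hrec n (h hC0))] with D cond_eq indep hD0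
    rw [post, cond_eq hD0]
    exact indep hD0

end PosteriorIndependence

end Model

section MeanKernel

variable {Ω V Y : Type*} [MeasurableSpace Ω] [MeasurableSpace V] [MeasurableSpace Y]

/-- The mean of a family of kernels whose parameter follows the law `ν`. -/
noncomputable def meanKernel (ν : Measure Ω) (T : Kernel (Ω × V) Y) : Kernel V Y :=
  T ∘ₖ (Kernel.const V ν ×ₖ Kernel.id)

variable {ν : Measure Ω} [IsProbabilityMeasure ν] {T : Kernel (Ω × V) Y}

instance [IsMarkovKernel T] : IsMarkovKernel (meanKernel ν T) := by
  unfold meanKernel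
  infer_instance

theorem lintegral_meanKernel (v : V) {F : Y → ℝ≥0∞} (hF : Measurable F) :
    ∫⁻ y, F y ∂(meanKernel ν T v) = ∫⁻ θ, ∫⁻ y, F y ∂(T (θ, v)) ∂ν := by
  have integral_dirac (θ : Ω) : ∫⁻ w, ∫⁻ y, F y ∂(T (θ, w)) ∂(Measure.dirac v) =
      ∫⁻ y, F y ∂(T (θ, v)) :=
    lintegral_dirac' v ((hF.lintegral_kernel (κ := T)).comp measurable_prodMk_left)
  rw [meanKernel, Kernel.lintegral_comp _ _ _ hF, Kernel.prod_apply, Kernel.const_apply,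
    Kernel.id_apply, lintegral_prod _ hF.lintegral_kernel.aemeasurable]
  exact lintegral_congr integral_dirac

theorem meanKernel_apply_of_ae_eq {v : V} {m : Measure Y} (h : ∀ᵐ θ ∂ν, T (θ, v) = m) :
    meanKernel ν T v = m := by
  refine Measure.ext_of_lintegral _ fun F hF => ?_
  rw [lintegral_meanKernel _ hF, lintegral_congr_ae (h.mono fun θ hθ => by rw [hθ])]
  simp

variable [IsMarkovKernel T] {u : Ω → Ω → Ω}

theorem IndepParts.meanKernel_prod {X : Type*} [MeasurableSpace X] (hν : IndepParts u ν)
    (hu : IsSplice u) {R : Kernel (Ω × V) X} [IsMarkovKernel R]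
    (hR : ∀ θ t v, R (u θ t, v) = R (θ, v)) (hT : ∀ θ t v, T (u θ t, v) = T (t, v)) :
    meanKernel ν (R ×ₖ T) = meanKernel ν R ×ₖ meanKernel ν T := by
  refine Kernel.ext fun v => Measure.ext_of_lintegral _ fun F hF => ?_
  have inner : Measurable fun q : Ω × X => ∫⁻ y, F (q.2, y) ∂(T (q.1, v)) :=
    measurable_lintegral_kernel T (by fun_prop) (by fun_prop)
  have mean_T (x : X) :
      ∫⁻ t, ∫⁻ y, F (x, y) ∂(T (t, v)) ∂ν = ∫⁻ y, F (x, y) ∂(meanKernel ν T v) :=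
    (lintegral_meanKernel v (by fun_prop)).symm
  have outcome : Measurable fun θ => ∫⁻ q, F q ∂((R ×ₖ T) (θ, v)) :=
    (hF.lintegral_kernel (κ := R ×ₖ T)).comp measurable_prodMk_right
  calc ∫⁻ q, F q ∂(meanKernel ν (R ×ₖ T) v)
      = ∫⁻ θ, ∫⁻ t, ∫⁻ x, ∫⁻ y, F (x, y) ∂(T (t, v)) ∂(R (θ, v)) ∂ν ∂ν := by
        rw [lintegral_meanKernel v hF, hν.lintegral hu outcome]
        simp only [Kernel.prod_apply, hR, hT, lintegral_prod _ hF.aemeasurable]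
    _ = ∫⁻ θ, ∫⁻ x, ∫⁻ t, ∫⁻ y, F (x, y) ∂(T (t, v)) ∂ν ∂(R (θ, v)) ∂ν :=
        lintegral_congr fun θ => lintegral_lintegral_swap
          (f := fun t x => ∫⁻ y, F (x, y) ∂(T (t, v))) inner.aemeasurable
    _ = ∫⁻ q, F q ∂((meanKernel ν R ×ₖ meanKernel ν T) v) := by
        simp only [mean_T]
        rw [Kernel.prod_apply, lintegral_prod _ hF.aemeasurable,
          lintegral_meanKernel v hF.lintegral_prod_right']

theorem IndepParts.lintegral_meanKernel_eq {W : Type*} [MeasurableSpace W] (hν : IndepParts u ν)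
    (hu : IsSplice u) (κ : Kernel Ω W) [IsMarkovKernel κ] (hκ : ∀ θ t, κ (u θ t) = κ θ)
    (hT : ∀ θ t v, T (u θ t, v) = T (t, v)) {v : W → V} (hv : Measurable v) {F : W × Y → ℝ≥0∞}
    (hF : Measurable F) :
    ∫⁻ θ, ∫⁻ w, ∫⁻ y, F (w, y) ∂(T (θ, v w)) ∂(κ θ) ∂ν =
      ∫⁻ θ, ∫⁻ w, ∫⁻ y, F (w, y) ∂(meanKernel ν T (v w)) ∂(κ θ) ∂ν := by
  have inner : Measurable fun q : Ω × W => ∫⁻ y, F (q.2, y) ∂(T (q.1, v q.2)) :=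
    measurable_lintegral_kernel T (by fun_prop) (by fun_prop)
  rw [hν.lintegral hu inner.lintegral_kernel_prod_right']
  refine lintegral_congr fun θ => ?_
  simp only [hκ, hT]
  rw [lintegral_lintegral_swap inner.aemeasurable]
  exact lintegral_congr fun w => (lintegral_meanKernel _ (by fun_prop)).symm

end MeanKernel

namespace Model

variable {S A : Type*} [MeasurableSpace S] [MeasurableSpace A] {H : ℕ}
  {ΘP ΘR : Fin H → Type*} [∀ h, MeasurableSpace (ΘP h)] [∀ h, MeasurableSpace (ΘR h)]
  {M : Model S A ΘP ΘR} {Pi : Set (Policy S A H)} (σ : M.OptimalSelector Pi)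

/-- The law of the first `n` layers in the environment `θ` under the policy `π*_{θ'}`, as a kernel
in `(θ, θ')`. -/
noncomputable def prefixOf (n : ℕ) (hn : n ≤ H) :
    Kernel (Param ΘP ΘR × Param ΘP ΘR) (Prefix S A n × S) :=
  prefixKernel (fun h => (M.transΘ h).comap (fun z => (z.1.1, z.2)) (by fun_prop))
    (fun h => (M.rewΘ h).comap (fun z => (z.1.1, z.2)) (by fun_prop))
    (fun h => (σ.kernel h).comap (fun z => (z.1.2, z.2)) (by fun_prop)) M.s₁ n hn

instance (n : ℕ) (hn : n ≤ H) : IsMarkovKernel (prefixOf σ n hn) := by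
  unfold prefixOf
  infer_instance

/-- The law of the first `n` layers in a fixed environment `E` under the policy `π*_{θ'}`, as a
kernel in `θ'`. -/
noncomputable def prefixIn (E : Env S A H) (n : ℕ) (hn : n ≤ H) :
    Kernel (Param ΘP ΘR) (Prefix S A n × S) :=
  prefixKernel (fun h => (E.trans h).prodMkLeft (Param ΘP ΘR))
    (fun h => (E.rew h).prodMkLeft (Param ΘP ΘR)) σ.kernel M.s₁ n hn

instance (E : Env S A H) (n : ℕ) (hn : n ≤ H) : IsMarkovKernel (prefixIn σ E n hn) := by
  unfold prefixIn
  infer_instance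

theorem prefixIn_congr {E E' : Env S A H} (n : ℕ) (hn : n ≤ H)
    (hP : ∀ h : Fin H, (h : ℕ) < n → E.trans h = E'.trans h)
    (hR : ∀ h : Fin H, (h : ℕ) < n → E.rew h = E'.rew h) (θ' : Param ΘP ΘR) :
    prefixIn σ E n hn θ' = prefixIn σ E' n hn θ' := by
  refine prefixKernel_congr _ _ _ _ _ _ _ _ (fun h hh x => ?_) (fun h hh x => ?_)
    fun _ _ _ => rfl
  · rw [hP h hh]
  · rw [hR h hh]

theorem meanEnv_trans (ν : Measure (Param ΘP ΘR)) [IsProbabilityMeasure ν] (h : Fin H) :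
    (M.meanEnv ν).trans h = meanKernel ν (M.transΘ h) := rfl

theorem meanEnv_rew (ν : Measure (Param ΘP ΘR)) [IsProbabilityMeasure ν] (h : Fin H) :
    (M.meanEnv ν).rew h = meanKernel ν (M.rewΘ h) := rfl

theorem prefixOf_splice_layer (n : ℕ) (hn : n < H) (θ t θ' : Param ΘP ΘR) :
    prefixOf σ n hn.le (splice (layer ⟨n, hn⟩) θ t, θ') = prefixOf σ n hn.le (θ, θ') := by
  refine prefixKernel_congr _ _ _ _ _ _ _ _ (fun j hj x => ?_) (fun j hj x => ?_)
    fun _ _ _ => rfl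
  · exact transΘ_splice_of_notMem _ _ _ _ _ (inl_mem_layer.not.2 (Fin.ne_of_lt hj))
  · exact rewΘ_splice_of_notMem _ _ _ _ _ (inr_mem_layer.not.2 (Fin.ne_of_lt hj))

theorem outcome_splice_layer (h : Fin H) (θ t : Param ΘP ΘR) (x : S × A) :
    (M.rewΘ h ×ₖ M.transΘ h) (splice (layer h) θ t, x) = (M.rewΘ h ×ₖ M.transΘ h) (t, x) := by
  rw [Kernel.prod_apply, Kernel.prod_apply, rewΘ_splice_of_mem _ _ _ _ _ (inr_mem_layer.2 rfl),
    transΘ_splice_of_mem _ _ _ _ _ (inl_mem_layer.2 rfl)]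

variable {ν : Measure (Param ΘP ΘR)} [IsProbabilityMeasure ν]

theorem meanKernel_outcome (hν : CoordIndep ν) (h : Fin H) :
    meanKernel ν (M.rewΘ h ×ₖ M.transΘ h) = (M.meanEnv ν).rew h ×ₖ (M.meanEnv ν).trans h :=
  (hν {.inl h}).meanKernel_prod (isSplice_splice _)
    (fun _ _ _ => rewΘ_splice_of_notMem _ _ _ _ _ (by simp))
    fun _ _ _ => transΘ_splice_of_mem _ _ _ _ _ (by simp)

/-- The law of the past, state and action in layer `n`, in the environment `θ` and under the policy
`π*_{θ'}`, as a kernel in `θ`. -/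
noncomputable def pastAction (n : ℕ) (hn : n < H) (θ' : Param ΘP ΘR) :
    Kernel (Param ΘP ΘR) ((Prefix S A n × S) × A) :=
  (prefixOf σ n hn.le).sectL θ' ⊗ₖ
    (actionGivenPast (σ.kernel ⟨n, hn⟩) θ' n).prodMkLeft (Param ΘP ΘR)

instance (n : ℕ) (hn : n < H) (θ' : Param ΘP ΘR) : IsMarkovKernel (pastAction σ n hn θ') := by
  unfold pastAction
  infer_instance

theorem lintegral_pastAction (n : ℕ) (hn : n < H) (θ θ' : Param ΘP ΘR)
    {G : (Prefix S A n × S) × A → ℝ≥0∞} (hG : Measurable G) :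
    ∫⁻ w, G w ∂(pastAction σ n hn θ' θ) =
      ∫⁻ p, ∫⁻ a, G (p, a) ∂(σ.kernel ⟨n, hn⟩ (θ', p.2)) ∂(prefixOf σ n hn.le (θ, θ')) :=
  Kernel.lintegral_compProd _ _ _ hG

theorem pastAction_splice_layer (n : ℕ) (hn : n < H) (θ t θ' : Param ΘP ΘR) :
    pastAction σ n hn θ' (splice (layer ⟨n, hn⟩) θ t) = pastAction σ n hn θ' θ := by
  refine Measure.ext_of_lintegral _ fun G hG => ?_
  rw [lintegral_pastAction σ n hn _ _ hG, lintegral_pastAction σ n hn _ _ hG,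
    prefixOf_splice_layer]

theorem lintegral_prefixOf_succ (n : ℕ) (hn : n < H) (θ θ' : Param ΘP ΘR)
    {F : Prefix S A (n + 1) × S → ℝ≥0∞} (hF : Measurable F) :
    ∫⁻ w, F w ∂(prefixOf σ (n + 1) hn (θ, θ')) =
      ∫⁻ w, ∫⁻ q, F (appendStep (w, q))
        ∂((M.rewΘ ⟨n, hn⟩ ×ₖ M.transΘ ⟨n, hn⟩) (θ, (w.1.2, w.2))) ∂(pastAction σ n hn θ' θ) := by
  have outcome : Measurable fun w : (Prefix S A n × S) × A => ∫⁻ q, F (appendStep (w, q))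
      ∂((M.rewΘ ⟨n, hn⟩ ×ₖ M.transΘ ⟨n, hn⟩) (θ, (w.1.2, w.2))) :=
    measurable_lintegral_kernel _ (by fun_prop) (by fun_prop)
  rw [lintegral_pastAction σ n hn θ θ' outcome, prefixOf,
    lintegral_prefixKernel_succ _ _ _ _ _ _ _ hF]
  simp only [Kernel.prod_apply, Kernel.comap_apply]
  rfl

theorem lintegral_prefixOf_eq_lintegral_prefixIn_meanEnv (hν : CoordIndep ν) (θ' : Param ΘP ΘR)
    (n : ℕ) (hn : n ≤ H) {F : Prefix S A n × S → ℝ≥0∞} (hF : Measurable F) :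
    ∫⁻ θ, ∫⁻ w, F w ∂(prefixOf σ n hn (θ, θ')) ∂ν =
      ∫⁻ w, F w ∂(prefixIn σ (M.meanEnv ν) n hn θ') := by
  induction n with
  | zero => simp [prefixOf, prefixIn, prefixKernel_zero_apply]
  | succ n ih =>
      let h : Fin H := ⟨n, hn⟩
      let outcome := M.rewΘ h ×ₖ M.transΘ h
      have mF : Measurable fun q : ((Prefix S A n × S) × A) × (unitInterval × S) =>
        F (appendStep q) := by fun_prop
      have measurable_step (κ : Kernel (S × A) (unitInterval × S)) [IsMarkovKernel κ] :
          Measurable fun w : (Prefix S A n × S) × A =>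
            ∫⁻ q, F (appendStep (w, q)) ∂(κ (w.1.2, w.2)) :=
        measurable_lintegral_kernel κ (by fun_prop) mF
      calc ∫⁻ θ, ∫⁻ w, F w ∂(prefixOf σ (n + 1) hn (θ, θ')) ∂ν
          = ∫⁻ θ, ∫⁻ w, ∫⁻ q, F (appendStep (w, q)) ∂(outcome (θ, (w.1.2, w.2)))
              ∂(pastAction σ n hn θ' θ) ∂ν :=
            lintegral_congr fun θ => lintegral_prefixOf_succ σ n hn θ θ' hF
        _ = ∫⁻ θ, ∫⁻ w, ∫⁻ q, F (appendStep (w, q)) ∂(meanKernel ν outcome (w.1.2, w.2))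
              ∂(pastAction σ n hn θ' θ) ∂ν :=
            (hν (layer h)).lintegral_meanKernel_eq (isSplice_splice _) (pastAction σ n hn θ')
              (pastAction_splice_layer σ n hn · · θ') (outcome_splice_layer h)
              (v := fun w => (w.1.2, w.2)) (by fun_prop) mF
        _ = ∫⁻ θ, ∫⁻ p, ∫⁻ a, ∫⁻ q, F (appendStep ((p, a), q))
              ∂(meanKernel ν outcome (p.2, a)) ∂(σ.kernel h (θ', p.2))
              ∂(prefixOf σ n (by omega) (θ, θ')) ∂ν :=
            lintegral_congr fun θ => lintegral_pastAction σ n hn _ _ (measurable_step _)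
        _ = ∫⁻ w, F w ∂(prefixIn σ (M.meanEnv ν) (n + 1) hn θ') := by
            have measurable_layer : Measurable fun p : Prefix S A n × S =>
                ∫⁻ a, ∫⁻ q, F (appendStep ((p, a), q)) ∂(meanKernel ν outcome (p.2, a))
                  ∂(σ.kernel h (θ', p.2)) :=
              measurable_lintegral_kernel _ (by fun_prop) (measurable_step (meanKernel ν outcome))
            rw [ih (by omega) measurable_layer, prefixIn, prefixIn,
              lintegral_prefixKernel_succ _ _ _ _ _ _ _ hF, meanKernel_outcome hν]
            simp only [Kernel.prod_apply, Kernel.prodMkLeft_apply]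
            rfl

end Model

section Conditioning

variable {Z : Type*} [MeasurableSpace Z] {ν : Measure Z} [IsProbabilityMeasure ν] {u : Z → Z → Z}

theorem IndepParts.ae_ae (h : IndepParts u ν) (hu : IsSplice u) {p : Z → Prop}
    (hp : ∀ᵐ z ∂ν, p z) : ∀ᵐ a ∂ν, ∀ᵐ b ∂ν, p (u a b) := by
  rw [← h] at hp
  exact Measure.ae_ae_of_ae_prod (ae_of_ae_map hu.measurable.aemeasurable hp)

theorem IndepParts.setLIntegral_of_rectangle (h : IndepParts u ν) (hu : IsSplice u) {C : Set Z}
    (hC : MeasurableSet C) {z : Z} (rectangle : ∀ a b, u a b ∈ C ↔ u a z ∈ C ∧ u z b ∈ C)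
    {Ψ : Z → ℝ≥0∞} (hΨ : Measurable Ψ) (right : ∀ a b, Ψ (u a b) = Ψ b) :
    ∫⁻ x in C, Ψ x ∂ν = ν {a | u a z ∈ C} * ∫⁻ b in {b | u z b ∈ C}, Ψ b ∂ν := by
  have hm := hu.measurable
  have hC₁ : MeasurableSet {a | u a z ∈ C} := (hm.comp measurable_prodMk_right) hC
  have hC₂ : MeasurableSet {b | u z b ∈ C} := (hm.comp measurable_prodMk_left) hC
  have split (a b : Z) : C.indicator Ψ (u a b) =
      {a | u a z ∈ C}.indicator 1 a * {b | u z b ∈ C}.indicator Ψ b := by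
    by_cases ha : u a z ∈ C <;> by_cases hb : u z b ∈ C <;>
      simp [Set.indicator, rectangle a b, ha, hb, right]
  rw [← lintegral_indicator hC, h.lintegral hu (hΨ.indicator hC)]
  simp_rw [split, lintegral_const_mul _ (hΨ.indicator hC₂)]
  rw [lintegral_mul_const _ (measurable_one.indicator hC₁), lintegral_indicator_one hC₁,
    lintegral_indicator hC₂]

theorem IndepParts.lintegral_cond_of_rectangle (h : IndepParts u ν) (hu : IsSplice u) {C : Set Z}
    (hC : MeasurableSet C) (hC0 : ν C ≠ 0) {z : Z}
    (rectangle : ∀ a b, u a b ∈ C ↔ u a z ∈ C ∧ u z b ∈ C) {Ψ : Z → ℝ≥0∞} (hΨ : Measurable Ψ)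
    (right : ∀ a b, Ψ (u a b) = Ψ b) :
    ∫⁻ x, Ψ x ∂(ν[|C]) = ∫⁻ b, Ψ b ∂(ν[|{b | u z b ∈ C}]) := by
  have measure_rectangle : ν C = ν {a | u a z ∈ C} * ν {b | u z b ∈ C} := by
    simpa using h.setLIntegral_of_rectangle hu hC rectangle measurable_one fun _ _ => rfl
  have left_ne_zero : ν {a | u a z ∈ C} ≠ 0 :=
    fun h0 => hC0 (by rw [measure_rectangle, h0, zero_mul])
  rw [ProbabilityTheory.cond, ProbabilityTheory.cond, lintegral_smul_measure,
    lintegral_smul_measure, h.setLIntegral_of_rectangle hu hC rectangle hΨ right,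
    measure_rectangle, smul_eq_mul, smul_eq_mul,
    ENNReal.mul_inv (Or.inl left_ne_zero) (Or.inl (measure_ne_top _ _)), mul_mul_mul_comm,
    ENNReal.inv_mul_cancel left_ne_zero (measure_ne_top _ _), one_mul]

end Conditioning

section Cells

variable {Ω : Type*} [MeasurableSpace Ω] {ν : Measure Ω} {K : ℕ} {ζ : Ω → Fin K}

theorem lintegral_comp_label (hζ : Measurable ζ) (G : Fin K → ℝ≥0∞) :
    ∫⁻ θ, G (ζ θ) ∂ν = ∑ k, ν (ζ ⁻¹' {k}) * G k := by
  rw [← lintegral_map (f := G) (by fun_prop) hζ, lintegral_fintype]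
  refine Finset.sum_congr rfl fun k _ => ?_
  rw [Measure.map_apply hζ (measurableSet_singleton k), mul_comm]

theorem lintegral_eq_sum_cell [IsFiniteMeasure ν] (hζ : Measurable ζ) (Ψ : Ω → ℝ≥0∞) :
    ∫⁻ θ, Ψ θ ∂ν = ∑ k, ν (ζ ⁻¹' {k}) * ∫⁻ θ, Ψ θ ∂(ν[|ζ ⁻¹' {k}]) := by
  conv_lhs => rw [← sum_meas_smul_cond_fiber hζ ν]
  rw [lintegral_finsetSum_measure]
  simp

theorem ae_cell_ne_zero : ∀ᵐ θ ∂ν, ν (ζ ⁻¹' {ζ θ}) ≠ 0 := by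
  have avoids_null (k : Fin K) : ∀ᵐ θ ∂ν, ν (ζ ⁻¹' {k}) = 0 → θ ∉ ζ ⁻¹' {k} := by
    by_cases hk : ν (ζ ⁻¹' {k}) = 0
    · exact (measure_eq_zero_iff_ae_notMem.1 hk).mono fun _ hθ _ => hθ
    · exact .of_forall fun _ h => absurd h hk
  filter_upwards [ae_all_iff.2 avoids_null] with θ hθ h0
  exact hθ _ h0 rfl

end Cells

/-- The cells of `ζ` are products over the layers: the cell of an environment amounts to the labels
`c h` of its layers. -/
def IsLabelledBy {H K : ℕ} {ΘP ΘR : Fin H → Type*} (ζ : Param ΘP ΘR → Fin K)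
    (c : ∀ h, ΘP h × ΘR h → ℕ) : Prop :=
  ∀ θ θ', ζ θ = ζ θ' ↔ ∀ h, c h (θ.1 h, θ.2 h) = c h (θ'.1 h, θ'.2 h)

section Layers

variable {H K : ℕ} {ΘP ΘR : Fin H → Type*} {ζ : Param ΘP ΘR → Fin K}
  {c : ∀ h, ΘP h × ΘR h → ℕ}

variable (c) in
theorem label_splice_layer_self (h : Fin H) (θ t : Param ΘP ΘR) :
    c h ((splice (layer h) θ t).1 h, (splice (layer h) θ t).2 h) = c h (t.1 h, t.2 h) := by
  rw [splice_fst_of_mem _ _ (inl_mem_layer.2 rfl),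
    splice_snd_of_mem _ _ (inr_mem_layer.2 rfl)]

variable (c) in
theorem label_splice_layer_of_ne {h j : Fin H} (hj : j ≠ h) (θ t : Param ΘP ΘR) :
    c j ((splice (layer h) θ t).1 j, (splice (layer h) θ t).2 j) = c j (θ.1 j, θ.2 j) := by
  rw [splice_fst_of_notMem _ _ (inl_mem_layer.not.2 hj),
    splice_snd_of_notMem _ _ (inr_mem_layer.not.2 hj)]

theorem IsLabelledBy.splice_layer_eq_iff (hc : IsLabelledBy ζ c) (h : Fin H)
    (θ t θ₀ : Param ΘP ΘR) :
    ζ (splice (layer h) θ t) = ζ θ₀ ↔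
      (∀ j ≠ h, c j (θ.1 j, θ.2 j) = c j (θ₀.1 j, θ₀.2 j)) ∧
        c h (t.1 h, t.2 h) = c h (θ₀.1 h, θ₀.2 h) := by
  rw [hc]
  refine ⟨fun hj => ⟨fun j hjh => ?_, ?_⟩, fun ⟨others, own⟩ j => ?_⟩
  · rw [← hj j, label_splice_layer_of_ne c hjh]
  · rw [← hj h, label_splice_layer_self c]
  · by_cases hjh : j = h
    · subst hjh
      rw [label_splice_layer_self c, own]
    · rw [label_splice_layer_of_ne c hjh, others j hjh]

variable [∀ h, MeasurableSpace (ΘP h)] [∀ h, MeasurableSpace (ΘR h)] {ν : Measure (Param ΘP ΘR)}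
  [IsProbabilityMeasure ν]

theorem IsLabelledBy.lintegral_cond_cell (hc : IsLabelledBy ζ c) (hζ : Measurable ζ)
    (hν : CoordIndep ν) (h : Fin H) {θ : Param ΘP ΘR} (hθ : ν (ζ ⁻¹' {ζ θ}) ≠ 0)
    {Ψ : Param ΘP ΘR → ℝ≥0∞} (hΨ : Measurable Ψ)
    (hΨh : ∀ a b, Ψ (splice (layer h) a b) = Ψ b) :
    ∫⁻ t, Ψ t ∂(ν[|ζ ⁻¹' {ζ θ}]) =
      ∫⁻ t, Ψ t ∂(ν[|{t | c h (t.1 h, t.2 h) = c h (θ.1 h, θ.2 h)}]) := by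
  have mem_cell (a b : Param ΘP ΘR) : splice (layer h) a b ∈ ζ ⁻¹' {ζ θ} ↔ _ :=
    hc.splice_layer_eq_iff h a b θ
  rw [(hν (layer h)).lintegral_cond_of_rectangle (isSplice_splice _)
    (hζ (measurableSet_singleton _)) hθ (z := θ) (fun a b => by simp [mem_cell]) hΨ hΨh]
  simp [mem_cell]

end Layers

namespace Model

variable {S A : Type*} [MeasurableSpace S] [MeasurableSpace A] {H : ℕ}
  {ΘP ΘR : Fin H → Type*} [∀ h, MeasurableSpace (ΘP h)] [∀ h, MeasurableSpace (ΘR h)]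
  {M : Model S A ΘP ΘR} {Pi : Set (Policy S A H)} (σ : M.OptimalSelector Pi)

theorem lintegral_occupancy (E : Env S A H) (θ' : Param ΘP ΘR) (h : Fin H) {G : S × A → ℝ≥0∞}
    (hG : Measurable G) :
    ∫⁻ x, G x ∂(occupancy σ E θ' h) =
      ∫⁻ p, ∫⁻ a, G (p.2, a) ∂(σ.kernel h (θ', p.2)) ∂(prefixIn σ E h h.2.le θ') := by
  rw [occupancy, lintegral_map hG (by fun_prop)]
  exact lintegral_stateAction_prefixKernel _ _ _ _ _ h hG H le_rfl h.2

variable {ν : Measure (Param ΘP ΘR)} [IsProbabilityMeasure ν] {K : ℕ} {ζ : Param ΘP ΘR → Fin K}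

theorem cellEnv_of_ne_zero {k : Fin K} (hk : ν (ζ ⁻¹' {k}) ≠ 0)
    [IsProbabilityMeasure (ν[|ζ ⁻¹' {k}])] :
    cellEnv M ν ζ k = M.meanEnv (ν[|ζ ⁻¹' {k}]) := by
  rw [cellEnv, dif_pos hk]

/-- All parameters are independent of each other, also conditionally on each cell of `ζ`. -/
structure CoordIndepOnCells (ν : Measure (Param ΘP ΘR)) (ζ : Param ΘP ΘR → Fin K) : Prop where
  coordIndep : CoordIndep ν
  cond : ∀ k, ν (ζ ⁻¹' {k}) ≠ 0 → CoordIndep (ν[|ζ ⁻¹' {k}])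

theorem lintegral_prefixIn_surrogate (hν : CoordIndepOnCells ν ζ) (hζ : Measurable ζ)
    (θ' : Param ΘP ΘR) (n : ℕ) (hn : n ≤ H) {F : Prefix S A n × S → ℝ≥0∞} (hF : Measurable F) :
    ∫⁻ θ, ∫⁻ w, F w ∂(prefixIn σ (surrogate M ν ζ θ) n hn θ') ∂ν =
      ∫⁻ w, F w ∂(prefixIn σ (M.meanEnv ν) n hn θ') := by
  rw [← lintegral_prefixOf_eq_lintegral_prefixIn_meanEnv σ hν.coordIndep θ' n hn hF,
    lintegral_eq_sum_cell hζ fun θ => ∫⁻ w, F w ∂(prefixOf σ n hn (θ, θ'))]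
  refine (lintegral_comp_label hζ fun k =>
    ∫⁻ w, F w ∂(prefixIn σ (cellEnv M ν ζ k) n hn θ')).trans (Finset.sum_congr rfl fun k _ => ?_)
  by_cases hk : ν (ζ ⁻¹' {k}) = 0
  · simp [hk]
  · have := cond_isProbabilityMeasure hk
    rw [cellEnv_of_ne_zero hk,
      lintegral_prefixOf_eq_lintegral_prefixIn_meanEnv σ (hν.cond k hk) θ' n hn hF]

section LayerCongr

variable {c : ∀ h, ΘP h × ΘR h → ℕ} (hc : IsLabelledBy ζ c) (hζ : Measurable ζ)
  (hν : CoordIndep ν) {θ t : Param ΘP ΘR} (hθ : ν (ζ ⁻¹' {ζ θ}) ≠ 0) (ht : ν (ζ ⁻¹' {ζ t}) ≠ 0)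

include hc hζ hν hθ ht

theorem meanKernel_cond_cell_congr {Y : Type*} [MeasurableSpace Y]
    {T : Kernel (Param ΘP ΘR × (S × A)) Y} {h : Fin H}
    (hT : ∀ a b x, T (splice (layer h) a b, x) = T (b, x))
    (label_eq : c h (θ.1 h, θ.2 h) = c h (t.1 h, t.2 h)) :
    meanKernel (ν[|ζ ⁻¹' {ζ θ}]) T = meanKernel (ν[|ζ ⁻¹' {ζ t}]) T := by
  have := cond_isProbabilityMeasure hθ
  have := cond_isProbabilityMeasure ht
  refine Kernel.ext fun x => Measure.ext_of_lintegral _ fun F hF => ?_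
  have hm : Measurable fun θ => ∫⁻ y, F y ∂(T (θ, x)) :=
    (hF.lintegral_kernel (κ := T)).comp measurable_prodMk_right
  have right (a b) :
      ∫⁻ y, F y ∂(T (splice (layer h) a b, x)) = ∫⁻ y, F y ∂(T (b, x)) := by rw [hT]
  rw [lintegral_meanKernel x hF, lintegral_meanKernel x hF,
    hc.lintegral_cond_cell hζ hν h hθ hm right, hc.lintegral_cond_cell hζ hν h ht hm right,
    label_eq]

theorem surrogate_trans_congr {h : Fin H}
    (label_eq : c h (θ.1 h, θ.2 h) = c h (t.1 h, t.2 h)) :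
    (surrogate M ν ζ θ).trans h = (surrogate M ν ζ t).trans h := by
  have := cond_isProbabilityMeasure hθ
  have := cond_isProbabilityMeasure ht
  rw [surrogate, surrogate, cellEnv_of_ne_zero hθ, cellEnv_of_ne_zero ht, meanEnv_trans,
    meanEnv_trans]
  exact meanKernel_cond_cell_congr hc hζ hν hθ ht
    (fun a b x => transΘ_splice_of_mem _ h a b x (inl_mem_layer.2 rfl)) label_eq

theorem surrogate_rew_congr {h : Fin H}
    (label_eq : c h (θ.1 h, θ.2 h) = c h (t.1 h, t.2 h)) :
    (surrogate M ν ζ θ).rew h = (surrogate M ν ζ t).rew h := by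
  have := cond_isProbabilityMeasure hθ
  have := cond_isProbabilityMeasure ht
  rw [surrogate, surrogate, cellEnv_of_ne_zero hθ, cellEnv_of_ne_zero ht, meanEnv_rew,
    meanEnv_rew]
  exact meanKernel_cond_cell_congr hc hζ hν hθ ht
    (fun a b x => rewΘ_splice_of_mem _ h a b x (inr_mem_layer.2 rfl)) label_eq

end LayerCongr

variable {c : ∀ h, ΘP h × ΘR h → ℕ}

/-- The mean of `f` over `(s_h, a_h)` in an episode of `π*_{θ'}` in `E`, where `f` may depend on
the kernels of layer `h` of a second environment `E'`. -/
noncomputable def layerMean (θ' : Param ΘP ΘR) (h : Fin H)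
    (f : Kernel (S × A) S → Kernel (S × A) unitInterval → S × A → ℝ≥0∞) (E E' : Env S A H) : ℝ≥0∞ :=
  ∫⁻ x, f (E'.trans h) (E'.rew h) x ∂(occupancy σ E θ' h)

theorem layerMean_surrogate_splice (hc : IsLabelledBy ζ c) (hζ : Measurable ζ) (hν : CoordIndep ν)
    (θ' : Param ΘP ΘR) (h : Fin H)
    {f : Kernel (S × A) S → Kernel (S × A) unitInterval → S × A → ℝ≥0∞}
    (hf : ∀ E : Env S A H, Measurable (f (E.trans h) (E.rew h))) {θ t : Param ΘP ΘR}
    (hθ : ν (ζ ⁻¹' {ζ θ}) ≠ 0) (ht : ν (ζ ⁻¹' {ζ t}) ≠ 0)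
    (hs : ν (ζ ⁻¹' {ζ (splice (layer h) θ t)}) ≠ 0) :
    layerMean σ θ' h f (surrogate M ν ζ (splice (layer h) θ t))
        (surrogate M ν ζ (splice (layer h) θ t)) =
      layerMean σ θ' h f (surrogate M ν ζ θ) (surrogate M ν ζ t) := by
  have past_eq : prefixIn σ (surrogate M ν ζ (splice (layer h) θ t)) h h.2.le θ' =
      prefixIn σ (surrogate M ν ζ θ) h h.2.le θ' :=
    prefixIn_congr σ h h.2.le
      (fun _ hj => surrogate_trans_congr hc hζ hν hs hθ
        (label_splice_layer_of_ne c (Fin.ne_of_lt hj) θ t))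
      (fun _ hj => surrogate_rew_congr hc hζ hν hs hθ
        (label_splice_layer_of_ne c (Fin.ne_of_lt hj) θ t)) θ'
  rw [layerMean, layerMean, lintegral_occupancy σ _ _ _ (hf _), lintegral_occupancy σ _ _ _ (hf _),
    past_eq, surrogate_trans_congr hc hζ hν hs ht (label_splice_layer_self c h θ t),
    surrogate_rew_congr hc hζ hν hs ht (label_splice_layer_self c h θ t)]

theorem lintegral_layerMean_surrogate_left (hν : CoordIndepOnCells ν ζ) (hζ : Measurable ζ)
    (θ' : Param ΘP ΘR) (h : Fin H)
    {f : Kernel (S × A) S → Kernel (S × A) unitInterval → S × A → ℝ≥0∞}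
    (hf : ∀ E : Env S A H, Measurable (f (E.trans h) (E.rew h))) (E' : Env S A H) :
    ∫⁻ θ, layerMean σ θ' h f (surrogate M ν ζ θ) E' ∂ν = layerMean σ θ' h f (M.meanEnv ν) E' := by
  have action_mean : Measurable fun p : Prefix S A h × S =>
      ∫⁻ a, f (E'.trans h) (E'.rew h) (p.2, a) ∂(σ.kernel h (θ', p.2)) :=
    measurable_lintegral_kernel _ (by fun_prop) ((hf E').comp (by fun_prop))
  simp_rw [layerMean, lintegral_occupancy σ _ _ _ (hf E')]
  exact lintegral_prefixIn_surrogate σ hν hζ θ' h h.2.le action_mean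

theorem lintegral_layerMean_surrogate (hc : IsLabelledBy ζ c) (hζ : Measurable ζ)
    (hν : CoordIndepOnCells ν ζ) (θ' : Param ΘP ΘR) (h : Fin H)
    {f : Kernel (S × A) S → Kernel (S × A) unitInterval → S × A → ℝ≥0∞}
    (hf : ∀ E : Env S A H, Measurable (f (E.trans h) (E.rew h))) :
    ∫⁻ θ, layerMean σ θ' h f (surrogate M ν ζ θ) (surrogate M ν ζ θ) ∂ν =
      ∫⁻ θ, layerMean σ θ' h f (M.meanEnv ν) (surrogate M ν ζ θ) ∂ν := by
  let G (k l : Fin K) := layerMean σ θ' h f (cellEnv M ν ζ k) (cellEnv M ν ζ l)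
  have hG : Measurable fun q : Param ΘP ΘR × Param ΘP ΘR => G (ζ q.1) (ζ q.2) :=
    (Measurable.of_discrete (f := fun q : Fin K × Fin K => G q.1 q.2)).comp
      (f := fun q : Param ΘP ΘR × Param ΘP ΘR => (ζ q.1, ζ q.2)) (by fun_prop)
  have hG_diag : Measurable fun θ => G (ζ θ) (ζ θ) :=
    (Measurable.of_discrete (f := fun k => G k k)).comp hζ
  calc ∫⁻ θ, G (ζ θ) (ζ θ) ∂ν
      = ∫⁻ θ, ∫⁻ t, G (ζ (splice (layer h) θ t)) (ζ (splice (layer h) θ t)) ∂ν ∂ν :=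
        (hν.coordIndep (layer h)).lintegral (isSplice_splice _) hG_diag
    _ = ∫⁻ θ, ∫⁻ t, G (ζ θ) (ζ t) ∂ν ∂ν := by
        refine lintegral_congr_ae ?_
        filter_upwards [(hν.coordIndep (layer h)).ae_ae (isSplice_splice _) ae_cell_ne_zero,
          ae_cell_ne_zero] with θ hs hθ
        refine lintegral_congr_ae ?_
        filter_upwards [hs, ae_cell_ne_zero] with t hst ht
        exact layerMean_surrogate_splice σ hc hζ hν.coordIndep θ' h hf hθ ht hst
    _ = ∫⁻ t, ∫⁻ θ, G (ζ θ) (ζ t) ∂ν ∂ν := lintegral_lintegral_swap hG.aemeasurable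
    _ = ∫⁻ t, layerMean σ θ' h f (M.meanEnv ν) (surrogate M ν ζ t) ∂ν :=
        lintegral_congr fun t => lintegral_layerMean_surrogate_left σ hν hζ θ' h hf _

end Model

namespace Model

variable {S A : Type*} [MeasurableSpace S] [MeasurableSpace A] {H : ℕ}
  {ΘP ΘR : Fin H → Type*} [∀ h, MeasurableSpace (ΘP h)] [∀ h, MeasurableSpace (ΘR h)]
  {M : Model S A ΘP ΘR} {Pi : Set (Policy S A H)} (σ : M.OptimalSelector Pi)

instance (E : Env S A H) : IsMarkovKernel (episodeIn σ E) := by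
  unfold episodeIn
  infer_instance

section MutualInformation

variable {O : Type*} [MeasurableSpace O] (obs : Traj S A H → O)

/-- The law of the record of an episode of `π*_{θ'}` in an environment `E`, as a kernel in `E`. -/
noncomputable def recordIn (θ' : Param ΘP ΘR) : Kernel (Env S A H) O where
  toFun E := (episodeIn σ E θ').map obs
  measurable' := measurable_from_top

theorem recordIn_apply (θ' : Param ΘP ΘR) (E : Env S A H) :
    recordIn σ obs θ' E = (episodeIn σ E θ').map obs := rfl

variable {obs} (hobs : Measurable obs)

include hobs in
theorem isMarkovKernel_recordIn (θ' : Param ΘP ΘR) : IsMarkovKernel (recordIn σ obs θ') :=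
  ⟨fun _ => Measure.isProbabilityMeasure_map hobs.aemeasurable⟩

variable {ν : Measure (Param ΘP ΘR)} [IsProbabilityMeasure ν] {K : ℕ} {ζ : Param ΘP ΘR → Fin K}
  {c : ∀ h, ΘP h × ΘR h → ℕ}

theorem measurable_surrogate (hζ : Measurable ζ) : Measurable (surrogate M ν ζ) :=
  (Measurable.of_discrete (f := cellEnv M ν ζ)).comp hζ

theorem lintegral_record (hν : CoordIndep ν) (θ' : Param ΘP ΘR) {F : O → ℝ≥0∞}
    (hF : Measurable F) :
    ∫⁻ θ, ∫⁻ o, F o ∂(record σ obs hobs (θ, θ')) ∂ν =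
      ∫⁻ o, F o ∂(recordIn σ obs θ' (M.meanEnv ν)) := by
  rw [recordIn_apply, lintegral_map hF hobs]
  simp_rw [record, Kernel.deterministic_comp_eq_map, Kernel.map_apply _ hobs, lintegral_map hF hobs]
  exact lintegral_prefixOf_eq_lintegral_prefixIn_meanEnv σ hν θ' H le_rfl (hF.comp hobs)

theorem lintegral_cond_cell_record (hν : CoordIndepOnCells ν ζ) (hζ : Measurable ζ)
    (θ' : Param ΘP ΘR) {F : Env S A H × O → ℝ≥0∞} (hF : Measurable F) {k : Fin K}
    (hk : ν (ζ ⁻¹' {k}) ≠ 0) :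
    ∫⁻ θ, ∫⁻ o, F (surrogate M ν ζ θ, o) ∂(record σ obs hobs (θ, θ')) ∂(ν[|ζ ⁻¹' {k}]) =
      ∫⁻ o, F (cellEnv M ν ζ k, o) ∂(recordIn σ obs θ' (cellEnv M ν ζ k)) := by
  have := cond_isProbabilityMeasure hk
  calc ∫⁻ θ, ∫⁻ o, F (surrogate M ν ζ θ, o) ∂(record σ obs hobs (θ, θ')) ∂(ν[|ζ ⁻¹' {k}])
      = ∫⁻ θ, ∫⁻ o, F (cellEnv M ν ζ k, o) ∂(record σ obs hobs (θ, θ')) ∂(ν[|ζ ⁻¹' {k}]) := by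
        refine lintegral_congr_ae ?_
        filter_upwards [ae_cond_mem (hζ (measurableSet_singleton k))] with θ hθ
        rw [surrogate, hθ]
    _ = ∫⁻ o, F (cellEnv M ν ζ k, o) ∂(recordIn σ obs θ' (cellEnv M ν ζ k)) := by
        rw [lintegral_record σ hobs (hν.cond k hk) θ'
          (F := fun o => F (cellEnv M ν ζ k, o)) (by fun_prop), ← cellEnv_of_ne_zero hk]

theorem jointLaw_eq_compProd (hν : CoordIndepOnCells ν ζ) (hζ : Measurable ζ)
    (θ' : Param ΘP ΘR) :
    jointLaw σ obs hobs ν ζ θ' = ν.map (surrogate M ν ζ) ⊗ₘ recordIn σ obs θ' := by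
  have := isMarkovKernel_recordIn σ hobs θ'
  have hs := measurable_surrogate (M := M) (ν := ν) hζ
  have := Measure.isProbabilityMeasure_map (μ := ν) hs.aemeasurable
  refine Measure.ext_of_lintegral _ fun F hF => ?_
  rw [jointLaw, lintegral_map hF (by fun_prop), Measure.lintegral_compProd (by fun_prop),
    Measure.lintegral_compProd hF, lintegral_map .of_discrete hs, lintegral_eq_sum_cell hζ]
  refine (Finset.sum_congr rfl fun k _ => ?_).trans (lintegral_comp_label hζ fun k =>
    ∫⁻ o, F (cellEnv M ν ζ k, o) ∂(recordIn σ obs θ' (cellEnv M ν ζ k))).symm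
  by_cases hk : ν (ζ ⁻¹' {k}) = 0
  · simp [hk]
  · exact congrArg _ (lintegral_cond_cell_record σ hobs hν hζ θ' hF hk)

theorem snd_jointLaw (hν : CoordIndep ν) (hζ : Measurable ζ) (θ' : Param ΘP ΘR) :
    (jointLaw σ obs hobs ν ζ θ').snd = recordIn σ obs θ' (M.meanEnv ν) := by
  have hs := measurable_surrogate (M := M) (ν := ν) hζ
  refine Measure.ext_of_lintegral _ fun F hF => ?_
  rw [Measure.snd, lintegral_map hF measurable_snd, jointLaw, lintegral_map (by fun_prop)
    (by fun_prop), Measure.lintegral_compProd (by fun_prop)]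
  exact lintegral_record σ hobs hν θ' hF

theorem mutualInfo_jointLaw (hν : CoordIndepOnCells ν ζ) (hζ : Measurable ζ) (θ' : Param ΘP ΘR) :
    mutualInfo (jointLaw σ obs hobs ν ζ θ') =
      ∫⁻ θ, klDiv ((episodeIn σ (surrogate M ν ζ θ) θ').map obs)
        ((episodeIn σ (M.meanEnv ν) θ').map obs) ∂ν := by
  have := isMarkovKernel_recordIn σ hobs θ'
  have : DiscreteMeasurableSpace (Env S A H) := ⟨fun _ => trivial⟩
  have law_surrogate : (ν.map ζ).map (cellEnv M ν ζ) = ν.map (surrogate M ν ζ) :=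
    Measure.map_map .of_discrete hζ
  have := Measure.isProbabilityMeasure_map (μ := ν) hζ.aemeasurable
  have := Measure.isProbabilityMeasure_map (μ := ν)
    (measurable_surrogate (M := M) (ν := ν) hζ).aemeasurable
  rw [mutualInfo, snd_jointLaw σ hobs hν.coordIndep hζ, jointLaw_eq_compProd σ hobs hν hζ,
    Measure.fst_compProd, ← Measure.compProd_const, ← law_surrogate,
    klDiv_map_compProd_eq_lintegral, lintegral_map .of_discrete hζ]
  rfl

theorem measurable_layerMean (h : Fin H)
    {f : Kernel (S × A) S → Kernel (S × A) unitInterval → S × A → ℝ≥0∞} (E E' : Env S A H)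
    (hf : Measurable (f (E'.trans h) (E'.rew h))) :
    Measurable fun θ' => layerMean σ θ' h f E E' := by
  simp_rw [layerMean, occupancy]
  have hm : Measurable fun w : Traj S A H => ((w.1 h).1, (w.1 h).2.1) := by fun_prop
  simp_rw [lintegral_map hf hm]
  exact (hf.comp hm).lintegral_kernel

theorem measurable_layerMean_surrogate (hζ : Measurable ζ) (h : Fin H) (E : Env S A H)
    {f : Kernel (S × A) S → Kernel (S × A) unitInterval → S × A → ℝ≥0∞}
    (hf : ∀ E : Env S A H, Measurable (f (E.trans h) (E.rew h))) :
    Measurable fun q : Param ΘP ΘR × Param ΘP ΘR => layerMean σ q.1 h f E (surrogate M ν ζ q.2) :=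
  (measurable_from_prod_countable_left (f := fun q : Param ΘP ΘR × Fin K =>
    layerMean σ q.1 h f E (cellEnv M ν ζ q.2)) fun k =>
      measurable_layerMean σ h E (cellEnv M ν ζ k) (hf _)).comp
      (f := fun q : Param ΘP ΘR × Param ΘP ΘR => (q.1, ζ q.2)) (by fun_prop)

theorem tsMutualInfo_eq_sum_tsExpect (hc : IsLabelledBy ζ c) (hν : CoordIndepOnCells ν ζ)
    (hζ : Measurable ζ)
    {f : Fin H → Kernel (S × A) S → Kernel (S × A) unitInterval → S × A → ℝ≥0∞}
    (hf : ∀ h (E : Env S A H), Measurable (f h (E.trans h) (E.rew h)))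
    (hKL : ∀ E θ', klDiv ((episodeIn σ E θ').map obs) ((episodeIn σ (M.meanEnv ν) θ').map obs) =
      ∑ h, layerMean σ θ' h (f h) E E) :
    tsMutualInfo σ obs hobs ν ζ =
      ∑ h, tsExpect σ ν ζ h fun E => f h (E.trans h) (E.rew h) := by
  have mean_layer (h : Fin H) := measurable_layerMean_surrogate σ (ν := ν) hζ h (M.meanEnv ν) (hf h)
  have own_layer (θ' : Param ΘP ΘR) (h : Fin H) : Measurable fun θ =>
      layerMean σ θ' h (f h) (surrogate M ν ζ θ) (surrogate M ν ζ θ) :=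
    (Measurable.of_discrete
      (f := fun k => layerMean σ θ' h (f h) (cellEnv M ν ζ k) (cellEnv M ν ζ k))).comp hζ
  calc tsMutualInfo σ obs hobs ν ζ
      = ∫⁻ θ', ∑ h, ∫⁻ θ, layerMean σ θ' h (f h) (M.meanEnv ν) (surrogate M ν ζ θ) ∂ν ∂ν := by
        refine lintegral_congr fun θ' => ?_
        simp_rw [mutualInfo_jointLaw σ hobs hν hζ θ', hKL]
        rw [lintegral_finsetSum _ fun h _ => own_layer θ' h]
        exact Finset.sum_congr rfl fun h _ =>
          lintegral_layerMean_surrogate σ hc hζ hν θ' h (hf h)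
    _ = ∑ h, ∫⁻ θ', ∫⁻ θ, layerMean σ θ' h (f h) (M.meanEnv ν) (surrogate M ν ζ θ) ∂ν ∂ν :=
        lintegral_finsetSum _ fun h _ => (mean_layer h).lintegral_prod_right'
    _ = ∑ h, tsExpect σ ν ζ h fun E => f h (E.trans h) (E.rew h) :=
        Finset.sum_congr rfl fun h _ => lintegral_lintegral_swap (mean_layer h).aemeasurable

end MutualInformation

section ChainRule

variable [MeasurableSpace.CountablyGenerated S]

theorem measurable_klDiv_transition_reward (E E' : Env S A H) (h : Fin H) :
    Measurable fun x : S × A =>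
      klDiv ((E.trans h x).prod (E.rew h x)) ((E'.trans h x).prod (E'.rew h x)) := by
  simpa only [Kernel.prod_apply] using
    measurable_klDiv_kernel (E.trans h ×ₖ E.rew h) (E'.trans h ×ₖ E'.rew h)

theorem measurable_klDiv_record_fst (E E' : Env S A H) (h : Fin H) :
    Measurable fun x : S × A =>
      if (h : ℕ) + 1 < H then
        klDiv ((E.trans h x).prod (E.rew h x)) ((E'.trans h x).prod (E'.rew h x))
      else klDiv (E.rew h x) (E'.rew h x) := by
  split_ifs
  · exact measurable_klDiv_transition_reward E E' h
  · exact measurable_klDiv_kernel _ _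

theorem klDiv_episodeIn (E E' : Env S A H) (θ' : Param ΘP ΘR) :
    klDiv (episodeIn σ E θ') (episodeIn σ E' θ') = ∑ h : Fin H,
      ∫⁻ x, klDiv ((E.trans h x).prod (E.rew h x)) ((E'.trans h x).prod (E'.rew h x))
        ∂(occupancy σ E θ' h) := by
  simp_rw [lintegral_occupancy σ _ θ' _ (measurable_klDiv_transition_reward E E' _)]
  exact klDiv_prefixKernel _ _ _ _ _ _ H le_rfl θ'

theorem klDiv_map_fst_episodeIn (E E' : Env S A H) (θ' : Param ΘP ΘR) :
    klDiv ((episodeIn σ E θ').map Prod.fst) ((episodeIn σ E' θ').map Prod.fst) = ∑ h : Fin H,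
      ∫⁻ x, (if (h : ℕ) + 1 < H then
        klDiv ((E.trans h x).prod (E.rew h x)) ((E'.trans h x).prod (E'.rew h x))
        else klDiv (E.rew h x) (E'.rew h x)) ∂(occupancy σ E θ' h) := by
  simp_rw [lintegral_occupancy σ _ θ' _ (measurable_klDiv_record_fst E E' _)]
  exact klDiv_map_fst_prefixKernel _ _ _ _ _ _ θ'

variable {ν : Measure (Param ΘP ΘR)} [IsProbabilityMeasure ν] {K : ℕ} {ζ : Param ΘP ΘR → Fin K}
  {c : ∀ h, ΘP h × ΘR h → ℕ}

theorem tsMutualInfo_id (hc : IsLabelledBy ζ c) (hν : CoordIndepOnCells ν ζ) (hζ : Measurable ζ) :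
    tsMutualInfo σ id measurable_id ν ζ = ∑ h : Fin H, tsExpect σ ν ζ h
      (fun E x => klDiv ((E.trans h x).prod (E.rew h x))
        (((M.meanEnv ν).trans h x).prod ((M.meanEnv ν).rew h x))) :=
  tsMutualInfo_eq_sum_tsExpect σ measurable_id hc hν hζ
    (f := fun h P R x => klDiv ((P x).prod (R x))
      (((M.meanEnv ν).trans h x).prod ((M.meanEnv ν).rew h x)))
    (fun h E => measurable_klDiv_transition_reward E _ h)
    fun E θ' => by
      rw [Measure.map_id, Measure.map_id]
      exact klDiv_episodeIn σ E _ θ'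

theorem tsMutualInfo_fst (hc : IsLabelledBy ζ c) (hν : CoordIndepOnCells ν ζ)
    (hζ : Measurable ζ) :
    tsMutualInfo σ Prod.fst measurable_fst ν ζ = ∑ h : Fin H, tsExpect σ ν ζ h
      (fun E x => if (h : ℕ) + 1 < H then
        klDiv ((E.trans h x).prod (E.rew h x))
          (((M.meanEnv ν).trans h x).prod ((M.meanEnv ν).rew h x))
        else klDiv (E.rew h x) ((M.meanEnv ν).rew h x)) :=
  tsMutualInfo_eq_sum_tsExpect σ measurable_fst hc hν hζ
    (f := fun h P R x => if (h : ℕ) + 1 < H then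
      klDiv ((P x).prod (R x)) (((M.meanEnv ν).trans h x).prod ((M.meanEnv ν).rew h x))
      else klDiv (R x) ((M.meanEnv ν).rew h x))
    (fun h E => measurable_klDiv_record_fst E _ h) fun E θ' => klDiv_map_fst_episodeIn σ E _ θ'

end ChainRule

end Model

namespace Model

variable {S A : Type*} [MeasurableSpace S] [MeasurableSpace A] {H : ℕ}
  {ΘP ΘR : Fin H → Type*} [∀ h, MeasurableSpace (ΘP h)] [∀ h, MeasurableSpace (ΘR h)]
  {M : Model S A ΘP ΘR} {Pi : Set (Policy S A H)} {σ : M.OptimalSelector Pi}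

section DeterministicRewards

variable {g : Fin H → Kernel (S × A) unitInterval}

theorem ae_prior_rewΘ_eq (hg : ∀ h, ∀ᵐ t ∂(M.priorR h), ∀ x, M.rew h (t, x) = g h x) :
    ∀ᵐ θ ∂M.prior, ∀ h x, M.rewΘ h (θ, x) = g h x :=
  ae_all_iff.2 fun h => Measure.quasiMeasurePreserving_snd.ae
    ((measurePreserving_eval M.priorR h).quasiMeasurePreserving.ae (hg h))

variable {ν : Measure (Param ΘP ΘR)} [IsProbabilityMeasure ν] {K : ℕ} {ζ : Param ΘP ΘR → Fin K}

theorem meanEnv_rew_apply_of_ae (hg : ∀ᵐ θ ∂ν, ∀ h x, M.rewΘ h (θ, x) = g h x) (h : Fin H)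
    (x : S × A) : (M.meanEnv ν).rew h x = g h x :=
  meanKernel_apply_of_ae_eq (hg.mono fun _ hθ => hθ h x)

theorem surrogate_rew_apply_eq_meanEnv (hg : ∀ᵐ θ ∂ν, ∀ h x, M.rewΘ h (θ, x) = g h x)
    (h : Fin H) (x : S × A) (θ : Param ΘP ΘR) :
    (surrogate M ν ζ θ).rew h x = (M.meanEnv ν).rew h x := by
  by_cases hk : ν (ζ ⁻¹' {ζ θ}) = 0
  · rw [surrogate, cellEnv, dif_neg (not_not.2 hk)]
  · have := cond_isProbabilityMeasure hk
    rw [surrogate, cellEnv_of_ne_zero hk, meanEnv_rew_apply_of_ae hg,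
      meanEnv_rew_apply_of_ae (cond_absolutelyContinuous.ae_le hg)]

variable [MeasurableSpace.CountablyGenerated S] {c : ∀ h, ΘP h × ΘR h → ℕ}

theorem tsMutualInfo_id_of_ae_rew (hc : IsLabelledBy ζ c) (hν : CoordIndepOnCells ν ζ)
    (hζ : Measurable ζ) (hg : ∀ᵐ θ ∂ν, ∀ h x, M.rewΘ h (θ, x) = g h x) :
    tsMutualInfo σ id measurable_id ν ζ = ∑ h : Fin H, tsExpect σ ν ζ h
      (fun E x => klDiv (E.trans h x) ((M.meanEnv ν).trans h x)) := by
  rw [tsMutualInfo_id σ hc hν hζ]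
  simp only [tsExpect, surrogate_rew_apply_eq_meanEnv hg, klDiv_prod_same_right]

theorem tsMutualInfo_fst_of_ae_rew (hc : IsLabelledBy ζ c) (hν : CoordIndepOnCells ν ζ)
    (hζ : Measurable ζ) (hg : ∀ᵐ θ ∂ν, ∀ h x, M.rewΘ h (θ, x) = g h x) :
    tsMutualInfo σ Prod.fst measurable_fst ν ζ = ∑ h : Fin H, tsExpect σ ν ζ h
      (fun E x => if (h : ℕ) + 1 < H then klDiv (E.trans h x) ((M.meanEnv ν).trans h x)
        else 0) := by
  rw [tsMutualInfo_fst σ hc hν hζ]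
  simp only [tsExpect, surrogate_rew_apply_eq_meanEnv hg, klDiv_prod_same_right, klDiv_self]

end DeterministicRewards

/-- A layered partition of the environments into the cells `{ζ = k}`: the cells are products over
the layers, and conditionally on a cell of positive prior mass all parameters are independent.
Unlike in an `ε`-value partition, nothing is required of the values within a cell. -/
structure IsLayeredPartition (M : Model S A ΘP ΘR) {K : ℕ} (ζ : Param ΘP ΘR → Fin K) : Prop where
  measurable : Measurable ζ
  layered : ∃ c, IsLabelledBy ζ c
  indep_layers : ∀ k, M.prior (ζ ⁻¹' {k}) ≠ 0 →
    iIndepFun (fun h θ => (θ.1 h, θ.2 h)) (M.prior[|ζ ⁻¹' {k}])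
  indep_rew : ∀ k, M.prior (ζ ⁻¹' {k}) ≠ 0 →
    ∀ h, IndepFun (fun θ => θ.1 h) (fun θ => θ.2 h) (M.prior[|ζ ⁻¹' {k}])

theorem IsLayeredValuePartition.isLayeredPartition {ε : ℝ} {K : ℕ} {ζ : Param ΘP ΘR → Fin K}
    (hζ : IsLayeredValuePartition σ ε ζ) : IsLayeredPartition M ζ where
  measurable := hζ.measurable
  layered := hζ.layered.imp fun _ hc => hc.2
  indep_layers := hζ.indep_layers
  indep_rew := hζ.indep_rew

theorem IsLayeredPartition.ae_coordIndepOnCells_post [∀ h, StandardBorelSpace (ΘP h)]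
    [∀ h, StandardBorelSpace (ΘR h)] [∀ h, Nonempty (ΘP h)] [∀ h, Nonempty (ΘR h)]
    {O : Type*} [MeasurableSpace O] {obs : Traj S A H → O} {hobs : Measurable obs} {K : ℕ}
    {ζ : Param ΘP ΘR → Fin K} (hζ : IsLayeredPartition M ζ)
    (hrec : ∀ I, RecordPreservesIndep σ obs hobs (splice I)) (n : ℕ) :
    ∀ᵐ D ∂(dataLaw σ obs hobs n), CoordIndepOnCells (post σ obs hobs n D) ζ := by
  have cond_prior (k : Fin K) (hk : M.prior (ζ ⁻¹' {k}) ≠ 0) :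
      CoordIndep (M.prior[|ζ ⁻¹' {k}]) := by
    have := cond_isProbabilityMeasure hk
    exact .of_layers (hζ.indep_layers k hk) (hζ.indep_rew k hk)
  filter_upwards [ae_coordIndep_post hrec n, ae_all_iff.2 fun k =>
    ae_coordIndep_cond_post hrec n (hζ.measurable (measurableSet_singleton k)) (cond_prior k)]
    with D indep cond_indep
  exact ⟨indep, cond_indep⟩

end Model

end BayesRL

open BayesRL BayesRL.Model in
theorem mainTheorem7_general {S A : Type*} [MeasurableSpace S] [MeasurableSpace A]
    [MeasurableSpace.CountablyGenerated S] {H : ℕ}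
    {ΘP ΘR : Fin H → Type*} [∀ h, MeasurableSpace (ΘP h)] [∀ h, MeasurableSpace (ΘR h)]
    [∀ h, StandardBorelSpace (ΘP h)] [∀ h, StandardBorelSpace (ΘR h)]
    [∀ h, Nonempty (ΘP h)] [∀ h, Nonempty (ΘR h)]
    (M : Model S A ΘP ΘR) (Pi : Set (Policy S A H)) (σ : M.OptimalSelector Pi) {K : ℕ}
    (ζ : Param ΘP ΘR → Fin K) (hζ : IsLayeredPartition M ζ) (n : ℕ) :
    (∀ᵐ D ∂(dataLaw σ id measurable_id n),
      tsMutualInfo σ id measurable_id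
          (post σ id measurable_id n D) ζ
        = ∑ h : Fin H, tsExpect σ (post σ id measurable_id n D) ζ h
            (fun E x => klDiv ((E.trans h x).prod (E.rew h x))
              (((M.meanEnv (post σ id measurable_id n D)).trans h x).prod
                ((M.meanEnv (post σ id measurable_id n D)).rew h x)))) ∧
    (∀ᵐ D ∂(dataLaw σ Prod.fst measurable_fst n),
      tsMutualInfo σ Prod.fst measurable_fst
          (post σ Prod.fst measurable_fst n D) ζ
        = ∑ h : Fin H,
            tsExpect σ (post σ Prod.fst measurable_fst n D) ζ h
            (fun E x => if (h : ℕ) + 1 < H then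
              klDiv ((E.trans h x).prod (E.rew h x))
                (((M.meanEnv (post σ Prod.fst measurable_fst n D)).trans h x).prod
                  ((M.meanEnv (post σ Prod.fst measurable_fst n D)).rew h x))
              else klDiv (E.rew h x)
                ((M.meanEnv (post σ Prod.fst measurable_fst n D)).rew h x))) ∧
    ((∃ g : Fin H → ProbabilityTheory.Kernel (S × A) unitInterval,
        ∀ h, ∀ᵐ t ∂(M.priorR h), ∀ x, M.rew h (t, x) = g h x) →
      (∀ᵐ D ∂(dataLaw σ id measurable_id n),
        tsMutualInfo σ id measurable_id
            (post σ id measurable_id n D) ζ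
          = ∑ h : Fin H,
              tsExpect σ (post σ id measurable_id n D) ζ h
              (fun E x => klDiv (E.trans h x)
                ((M.meanEnv (post σ id measurable_id n D)).trans h x))) ∧
      (∀ᵐ D ∂(dataLaw σ Prod.fst measurable_fst n),
        tsMutualInfo σ Prod.fst measurable_fst
            (post σ Prod.fst measurable_fst n D) ζ
          = ∑ h : Fin H,
              tsExpect σ (post σ Prod.fst measurable_fst n D) ζ h
              (fun E x => if (h : ℕ) + 1 < H then
                klDiv (E.trans h x)
                  ((M.meanEnv (post σ Prod.fst measurable_fst n D)).trans h x)
                else 0))) := by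
  obtain ⟨c, hc⟩ := hζ.layered
  have full := hζ.ae_coordIndepOnCells_post (fun I => recordPreservesIndep_id σ
    (isSplice_splice I) (factorsThroughOne_transΘ I) (factorsThroughOne_rewΘ I)) n
  have truncated := hζ.ae_coordIndepOnCells_post (fun I => recordPreservesIndep_fst σ
    (isSplice_splice I) (factorsThroughOne_transΘ I) (factorsThroughOne_rewΘ I)) n
  refine ⟨full.mono fun D hD => tsMutualInfo_id σ hc hD hζ.measurable,
    truncated.mono fun D hD => tsMutualInfo_fst σ hc hD hζ.measurable, ?_⟩
  rintro ⟨g, hg⟩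
  have known_rew := ae_prior_rewΘ_eq hg
  constructor
  · filter_upwards [full, ae_ae_post_of_ae_prior n known_rew] with D hD hrew
    exact tsMutualInfo_id_of_ae_rew hc hD hζ.measurable hrew
  · filter_upwards [truncated, ae_ae_post_of_ae_prior n known_rew] with D hD hrew
    exact tsMutualInfo_fst_of_ae_rew hc hD hζ.measurable hrew

theorem mainTheorem7 {S A : Type*} [MeasurableSpace S] [MeasurableSpace A]
    [MeasurableSpace.CountablyGenerated S] [MeasurableSpace.CountablyGenerated A] {H : ℕ}
    {ΘP ΘR : Fin H → Type*} [∀ h, MeasurableSpace (ΘP h)] [∀ h, MeasurableSpace (ΘR h)]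
    [∀ h, StandardBorelSpace (ΘP h)] [∀ h, StandardBorelSpace (ΘR h)]
    [∀ h, Nonempty (ΘP h)] [∀ h, Nonempty (ΘR h)]
    (M : BayesRL.Model S A ΘP ΘR) (Pi : Set (BayesRL.Policy S A H))
    (σ : M.OptimalSelector Pi) (ε : ℝ) (_hε : 0 < ε) {K : ℕ}
    (ζ : BayesRL.Param ΘP ΘR → Fin K)
    (_hζ : BayesRL.Model.IsLayeredValuePartition σ ε ζ) (n : ℕ) :
    -- the history of an episode records the terminal state
    (∀ᵐ D ∂(BayesRL.Model.dataLaw σ id measurable_id n),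
      BayesRL.Model.tsMutualInfo σ id measurable_id
          (BayesRL.Model.post σ id measurable_id n D) ζ
        = ∑ h : Fin H, BayesRL.Model.tsExpect σ (BayesRL.Model.post σ id measurable_id n D) ζ h
            (fun E x => klDiv ((E.trans h x).prod (E.rew h x))
              (((M.meanEnv (BayesRL.Model.post σ id measurable_id n D)).trans h x).prod
                ((M.meanEnv (BayesRL.Model.post σ id measurable_id n D)).rew h x)))) ∧
    -- the history of an episode ends with the last reward
    (∀ᵐ D ∂(BayesRL.Model.dataLaw σ Prod.fst measurable_fst n),
      BayesRL.Model.tsMutualInfo σ Prod.fst measurable_fst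
          (BayesRL.Model.post σ Prod.fst measurable_fst n D) ζ
        = ∑ h : Fin H,
            BayesRL.Model.tsExpect σ (BayesRL.Model.post σ Prod.fst measurable_fst n D) ζ h
            (fun E x => if (h : ℕ) + 1 < H then
              klDiv ((E.trans h x).prod (E.rew h x))
                (((M.meanEnv (BayesRL.Model.post σ Prod.fst measurable_fst n D)).trans h x).prod
                  ((M.meanEnv (BayesRL.Model.post σ Prod.fst measurable_fst n D)).rew h x))
              else klDiv (E.rew h x)
                ((M.meanEnv (BayesRL.Model.post σ Prod.fst measurable_fst n D)).rew h x))) ∧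
    -- the special case of deterministic rewards, for both kinds of histories
    ((∃ g : Fin H → ProbabilityTheory.Kernel (S × A) unitInterval,
        ∀ h, ∀ᵐ t ∂(M.priorR h), ∀ x, M.rew h (t, x) = g h x) →
      (∀ᵐ D ∂(BayesRL.Model.dataLaw σ id measurable_id n),
        BayesRL.Model.tsMutualInfo σ id measurable_id
            (BayesRL.Model.post σ id measurable_id n D) ζ
          = ∑ h : Fin H,
              BayesRL.Model.tsExpect σ (BayesRL.Model.post σ id measurable_id n D) ζ h
              (fun E x => klDiv (E.trans h x)
                ((M.meanEnv (BayesRL.Model.post σ id measurable_id n D)).trans h x))) ∧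
      (∀ᵐ D ∂(BayesRL.Model.dataLaw σ Prod.fst measurable_fst n),
        BayesRL.Model.tsMutualInfo σ Prod.fst measurable_fst
            (BayesRL.Model.post σ Prod.fst measurable_fst n D) ζ
          = ∑ h : Fin H,
              BayesRL.Model.tsExpect σ (BayesRL.Model.post σ Prod.fst measurable_fst n D) ζ h
              (fun E x => if (h : ℕ) + 1 < H then
                klDiv (E.trans h x)
                  ((M.meanEnv (BayesRL.Model.post σ Prod.fst measurable_fst n D)).trans h x)
                else 0))) :=
  mainTheorem7_general M Pi σ ζ _hζ.isLayeredPartition n
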